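/- Logarithms are to base 2. Consider the $k$-receiver AWGN broadcast channel with noiseless causal feedback, $Y_{ji}=X_i+Z_{ji}$ ($1\le j\le k$, $i\ge 1$), where the $Z_{ji}$ are independent $N(0,1)$ variables, independent of the messages. A $(2^{nR_1},\dots,2^{nR_k},n)$ code has independent uniform messages $M_j\in\{1,\dots,\lceil 2^{nR_j}\rceil\}$, inputs $X_i$ that depend on $(M_1,\dots,M_k)$ and on all past outputs, and decoders that estimate $M_j$ from $(Y_{j1},\dots,Y_{jn})$. The rate vector $(R_1,\dots,R_k)$ is achievable under power constraint $P$ if for some sequence of such codes the probability that some receiver errs tends to $0$ and $\limsup_n \frac1n\sum_{i\le n}\mathbb E X_i^2\le P$. For a real $a>1$ let $A=\mathrm{diag}(a_1,\dots,a_k)$ with $a_j=a\,e^{2\pi\sqrt{-1}(j-1)/k}$, $B=(1,\dots,1)^T$, and let $'$ denote the conjugate transpose. The LQG code is given by the linear control $X_i=-C\mathbf S_i$ of the system $\mathbf S_1=\mathbf\Theta$, $\mathbf S_{i+1}=A\mathbf S_i+\mathbf Y_i$, over the complex channel $\mathbf Y_i=BX_i+\mathbf Z_i$ with $\mathbf Z_i\sim\mathcal{CN}(0,I)$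 i.i.d. and independent of $\mathbf\Theta$, where $C=(B'GB+1)^{-1}B'GA$ and $G$ is the positive definite solution of $G=A'GA-A'GB(B'GB+1)^{-1}B'GA$ for which all eigenvalues of $A-BC$ lie inside the unit circle. Receiver $j$ forms the estimate $\hat\Theta_{jn}=-a_j^{-n}\hat S_{j(n+1)}$, where $\hat S_{j1}=0$ and $\hat S_{j(i+1)}=a_j\hat S_{ji}+Y_{ji}$. For continuous messages, the $\Theta_j$ are independent and uniform on the unit square $(0,1)\times(0,1)\subset\mathbb C$. For discrete messages over the real channel, $\Theta_j$ is a message point in the unit square that represents $M_j$, each complex transmission is carried out as two consecutive real ones (with inputs scaled by $\sqrt2$ and outputs by $1/\sqrt2$, which matches noise and power), and receiver $j$ decides for the message point closest to its estimate. Theorem. Let $k\ge1$. (a) For every $P>0$ the equation $$(1+P\phi)^{k-1}=\Bigl(1+\frac Pk\,\phi\,(k-\phi)\Bigr)^k$$ has a unique solution $\phi=\phi(k,P)$ in the interval $[1,k]$. Put $R(k,P)=\frac12\log(1+P\phi(k,P))$. (b) For every $a>1$ the matrix $G$ exists and is unique. With $P=\mathrm{tr}(G)>0$, the control $X_i=-C\mathbf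 S_i$ is stabilizing ($\limsup_n\mathbb E\|\mathbf S_n\|^2<\infty$), it minimizes the asymptotic average power among all stabilizing controls $X_i=\pi_i(\mathbf S_i)$, and $\frac1n\sum_{i\le n}\mathbb E|X_i|^2\to P$. Moreover $\log a=R(k,P)/k$, the code has mean square error exponents $\lim_n-\frac1{2n}\log\mathbb E|\Theta_j-\hat\Theta_{jn}|^2=R(k,P)/k$ for $j=1,\dots,k$, and for every rate vector with $R_j<R(k,P)/k$ for all $j$, the LQG codes for this $a$ over the real channel, with suitable message points, achieve that rate vector under power constraint $P$. (c) Every $P>0$ equals $\mathrm{tr}(G)$ for exactly one $a>1$, and the symmetric rate vector $R_j=R(k,P)/k$, $j=1,\dots,k$, of sum rate $R(k,P)$, is itself achievable under power constraint $P$. -/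

import Mathlib

open MeasureTheory ProbabilityTheory Filter Topology
open scoped ENNReal ComplexOrder ComplexConjugate

namespace GaussianBC

/-! ### The real `k`-receiver AWGN broadcast channel with feedback, independent noises -/

/-- The number `⌈2 ^ (n R)⌉` of messages at rate `R` (bits per transmission), block length `n`. -/
noncomputable def messageCount (n : ℕ) (R : ℝ) : ℕ := ⌈(2 : ℝ) ^ ((n : ℝ) * R)⌉₊

/-- A code of block length `n` with `M j` messages for receiver `j`. The symbol sent at time `i`
is a function of the message vector and of the output vectors at the times `l < i`; the estimate
of receiver `j` is a function of its own `n` outputs. -/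
structure FeedbackCode (k n : ℕ) (M : Fin k → ℕ) where
  /-- the encoder -/
  enc : (i : Fin n) → ((j : Fin k) → Fin (M j)) → (Fin (i : ℕ) → Fin k → ℝ) → ℝ
  /-- the decoders -/
  dec : (j : Fin k) → (Fin n → ℝ) → Fin (M j)
  measurable_enc : ∀ i m, Measurable (enc i m)
  measurable_dec : ∀ j, Measurable (dec j)

namespace FeedbackCode

variable {k n : ℕ} {M : Fin k → ℕ}

/-- The vector of channel outputs at time `i`, for the message vector `m` and the noise `z`:
`Y_{ji} = X_i(m, Y^{i-1}) + Z_{ji}`. -/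
noncomputable def output (c : FeedbackCode k n M) (m : (j : Fin k) → Fin (M j))
    (z : Fin n → Fin k → ℝ) (i : Fin n) : Fin k → ℝ := fun j =>
  c.enc i m (fun l : Fin (i : ℕ) => c.output m z ⟨(l : ℕ), l.2.trans i.2⟩) + z i j
termination_by (i : ℕ)
decreasing_by exact l.2

/-- The channel input at time `i`. -/
noncomputable def input (c : FeedbackCode k n M) (m : (j : Fin k) → Fin (M j))
    (z : Fin n → Fin k → ℝ) (i : Fin n) : ℝ :=
  c.enc i m (fun l : Fin (i : ℕ) => c.output m z ⟨(l : ℕ), l.2.trans i.2⟩)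

/-- The law of the noise in `n` transmissions: independent `N(0, 1)` variables over the times and
over the receivers (noise covariance matrix equal to the identity). -/
noncomputable def noiseLaw (k n : ℕ) : Measure (Fin n → Fin k → ℝ) :=
  Measure.pi fun _ => Measure.pi fun _ => gaussianReal 0 1

/-- The probability that some receiver errs, for independent and uniform messages that are
independent of the noise. -/
noncomputable def errorProb (c : FeedbackCode k n M) : ℝ≥0∞ :=
  (∑ m : (j : Fin k) → Fin (M j),
      noiseLaw k n {z | ∃ j, c.dec j (fun i => c.output m z i j) ≠ m j}) /
    (Fintype.card ((j : Fin k) → Fin (M j)) : ℝ≥0∞)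

/-- The average power `(1 / n) ∑ i, E (X_i ^ 2)`, for independent and uniform messages that are
independent of the noise. -/
noncomputable def avgPower (c : FeedbackCode k n M) : ℝ≥0∞ :=
  (∑ i : Fin n, (∑ m : (j : Fin k) → Fin (M j),
      ∫⁻ z, ENNReal.ofReal (c.input m z i ^ 2) ∂(noiseLaw k n)) /
    (Fintype.card ((j : Fin k) → Fin (M j)) : ℝ≥0∞)) / (n : ℝ≥0∞)

end FeedbackCode

/-- The rate vector `r` is achievable under the (asymptotic block) power constraint `P`. -/
def Achievable (k : ℕ) (P : ℝ) (r : Fin k → ℝ) : Prop :=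
  ∃ c : (n : ℕ) → FeedbackCode k n (fun j => messageCount n (r j)),
    Tendsto (fun n => (c n).errorProb) atTop (𝓝 0) ∧
    limsup (fun n => (c n).avgPower) atTop ≤ ENNReal.ofReal P

/-! ### The complex channel and the control problem -/

/-- The circularly symmetric complex Gaussian law `CN(0, 1)`, with `E |Z|² = 1`. -/
noncomputable def complexGaussian : Measure ℂ :=
  ((gaussianReal 0 (1 / 2)).prod (gaussianReal 0 (1 / 2))).map fun p => (⟨p.1, p.2⟩ : ℂ)

theorem measurable_complexMk : Measurable fun p : ℝ × ℝ => (⟨p.1, p.2⟩ : ℂ) :=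
  Complex.measurableEquivRealProd.symm.measurable

instance : IsProbabilityMeasure complexGaussian :=
  Measure.isProbabilityMeasure_map measurable_complexMk.aemeasurable

/-- The uniform law on the open unit square `(0, 1) × (0, 1)` of the complex plane. -/
noncomputable def unifSquare : Measure ℂ :=
  volume.restrict (Set.Ioo (0 : ℝ) 1 ×ℂ Set.Ioo (0 : ℝ) 1)

/-- Sample space of the complex system: the initial state `Θ` and the noise sequence `Z`. -/
abbrev Sample (k : ℕ) : Type := (Fin k → ℂ) × (ℕ → Fin k → ℂ)

/-- The components of `Θ` are i.i.d. uniform on the unit square, the noise vectors are i.i.d.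
`CN(0, I)`, and `Θ` and the noise are independent. -/
noncomputable def sampleLaw (k : ℕ) : Measure (Sample k) :=
  (Measure.pi fun _ : Fin k => unifSquare).prod
    (Measure.infinitePi fun _ : ℕ => Measure.pi fun _ : Fin k => complexGaussian)

/-- The state of the open-loop system `diag(a)` driven by the channel outputs `y`:
`S_1 = Θ`, `S_i = A S_{i-1} + Y_{i-1}`. Times are counted from `0` here, so that the value at `n`
is the state after `n` transmissions. -/
noncomputable def plantState {k : ℕ} (a θ : Fin k → ℂ) (y : ℕ → Fin k → ℂ) : ℕ → Fin k → ℂ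
  | 0 => θ
  | i + 1 => fun j => a j * plantState a θ y i j + y i j

/-- A control: the symbol sent at time `i` is a function of the state at time `i`. -/
abbrev Control (k : ℕ) : Type := ℕ → (Fin k → ℂ) → ℂ

/-- The closed-loop state under the control `π`, where `Y_i = B X_i + Z_i`, `B = (1, …, 1)ᵀ` and
`X_i = π_i(S_i)`. -/
noncomputable def closedLoop {k : ℕ} (a : Fin k → ℂ) (π : Control k) (ω : Sample k) :
    ℕ → Fin k → ℂ
  | 0 => ω.1
  | i + 1 => fun j => a j * closedLoop a π ω i j + (π i (closedLoop a π ω i) + ω.2 i j)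

/-- The outputs of the complex channel in closed loop. -/
noncomputable def channelOutput {k : ℕ} (a : Fin k → ℂ) (π : Control k) (ω : Sample k)
    (i : ℕ) (j : Fin k) : ℂ :=
  π i (closedLoop a π ω i) + ω.2 i j

/-- The state of a receiver: `Ŝ_1 = 0`, `Ŝ_i = a Ŝ_{i-1} + Y_{i-1}` (times counted from `0`). -/
noncomputable def receiverState (a : ℂ) (y : ℕ → ℂ) : ℕ → ℂ
  | 0 => 0
  | i + 1 => a * receiverState a y i + y i

/-- The estimate `-a^{-n} Ŝ_{n+1}` of the message after `n` transmissions. -/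
noncomputable def receiverEstimate (a : ℂ) (y : ℕ → ℂ) (n : ℕ) : ℂ :=
  -(a ^ n)⁻¹ * receiverState a y n

/-- The control stabilizes the closed-loop system: `limsup E ‖S_n‖² < ∞`. -/
def Stabilizes {k : ℕ} (a : Fin k → ℂ) (π : Control k) : Prop :=
  limsup (fun n => ∫⁻ ω, ENNReal.ofReal (∑ j, ‖closedLoop a π ω n j‖ ^ 2) ∂(sampleLaw k)) atTop < ⊤

/-- The average control power `(1 / n) ∑_{i ≤ n} E |X_i|²`. -/
noncomputable def controlPower {k : ℕ} (a : Fin k → ℂ) (π : Control k) (n : ℕ) : ℝ≥0∞ :=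
  (∑ i ∈ Finset.range n,
    ∫⁻ ω, ENNReal.ofReal (‖π i (closedLoop a π ω i)‖ ^ 2) ∂(sampleLaw k)) / (n : ℝ≥0∞)

/-- `π` is stabilizing and has the least asymptotic average power of all stabilizing controls. -/
def IsMinimumPowerControl {k : ℕ} (a : Fin k → ℂ) (π : Control k) : Prop :=
  Stabilizes a π ∧ ∀ π' : Control k, (∀ i, Measurable (π' i)) → Stabilizes a π' →
    limsup (controlPower a π) atTop ≤ limsup (controlPower a π') atTop

/-- The mean square error `E |Θ_j - Θ̂_j|²` of receiver `j` after `n` transmissions. -/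
noncomputable def meanSquareError {k : ℕ} (a : Fin k → ℂ) (π : Control k) (j : Fin k) (n : ℕ) :
    ℝ≥0∞ :=
  ∫⁻ ω, ENNReal.ofReal
    (‖ω.1 j - receiverEstimate (a j) (fun i => channelOutput a π ω i j) n‖ ^ 2) ∂(sampleLaw k)

/-- The code given by the control `π` has mean square error exponent `E` at receiver `j`. -/
def HasMSEExponent {k : ℕ} (a : Fin k → ℂ) (π : Control k) (j : Fin k) (E : ℝ) : Prop :=
  (∀ n, meanSquareError a π j n ≠ ⊤) ∧
  Tendsto (fun n : ℕ => -(1 / (2 * (n : ℝ))) * Real.logb 2 (meanSquareError a π j n).toReal)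
    atTop (𝓝 E)

/-! ### The LQG control -/

/-- The input matrix `B = (1, …, 1)ᵀ`. -/
def inputMatrix (k : ℕ) : Matrix (Fin k) (Fin 1) ℂ := fun _ _ => 1

/-- The gain `C = (B' G B + 1)⁻¹ B' G A`, with `A = diag(a)` and `'` the conjugate transpose. -/
noncomputable def lqgGain {k : ℕ} (a : Fin k → ℂ) (G : Matrix (Fin k) (Fin k) ℂ) :
    Matrix (Fin 1) (Fin k) ℂ :=
  ((inputMatrix k).conjTranspose * G * inputMatrix k + 1)⁻¹ *
    ((inputMatrix k).conjTranspose * G * Matrix.diagonal a)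

/-- `G` is a positive definite solution of the discrete algebraic Riccati equation
`G = A' G A - A' G B (B' G B + 1)⁻¹ B' G A` such that every eigenvalue of `A - B C` lies inside the
unit circle. -/
def IsStabilizingDARESolution {k : ℕ} (a : Fin k → ℂ) (G : Matrix (Fin k) (Fin k) ℂ) : Prop :=
  G.PosDef ∧
  G = (Matrix.diagonal a).conjTranspose * G * Matrix.diagonal a -
      (Matrix.diagonal a).conjTranspose * G * inputMatrix k *
        ((inputMatrix k).conjTranspose * G * inputMatrix k + 1)⁻¹ *
        ((inputMatrix k).conjTranspose * G * Matrix.diagonal a) ∧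
  ∀ μ ∈ spectrum ℂ (Matrix.diagonal a - inputMatrix k * lqgGain a G), ‖μ‖ < 1

/-- The stationary linear control `X_i = -C S_i`. -/
noncomputable def lqgControl {k : ℕ} (a : Fin k → ℂ) (G : Matrix (Fin k) (Fin k) ℂ) : Control k :=
  fun _ s => -∑ j, lqgGain a G 0 j * s j

/-! ### From the complex system to codes for the real channel -/

/-- Complex outputs from real ones: the two consecutive real transmissions `2s` and `2s + 1` give
the complex output `(y_{2s} + i y_{2s+1}) / √2`. With `N(0, 1)` noise in each real transmission the
complex noise is `CN(0, 1)`. Outputs that are not available are replaced by `0`. -/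
noncomputable def pairOutputs {n : ℕ} (y : Fin n → ℝ) (s : ℕ) : ℂ :=
  if h : 2 * s + 1 < n then
    (⟨y ⟨2 * s, by omega⟩ / √2, y ⟨2 * s + 1, h⟩ / √2⟩ : ℂ)
  else 0

/-- `c` is the code of block length `n` for the real channel that is given by the control `π` for
the system `diag(a)` and the message points `θ`. The complex symbol number `t` is `π_t(S_t)`, where
`S` starts at the message points of the messages and is driven by the complex outputs; it is sent
as `√2 Re π_t(S_t)`, `√2 Im π_t(S_t)` in the real transmissions `2t`, `2t + 1`, so the power per
real transmission is the power of the complex symbol (the last transmission is idle if `n` is odd).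
Receiver `j` decides for a message whose message point is closest to its estimate. -/
def IsControlCode {k n : ℕ} {M : Fin k → ℕ} (a : Fin k → ℂ) (π : Control k)
    (θ : (j : Fin k) → Fin (M j) → ℂ) (c : FeedbackCode k n M) : Prop :=
  (∀ (i : Fin n) (m : (j : Fin k) → Fin (M j)) (y : Fin (i : ℕ) → Fin k → ℝ),
    c.enc i m y =
      if 2 * ((i : ℕ) / 2) + 1 < n then
        √2 * (if (i : ℕ) % 2 = 0 then
          (π ((i : ℕ) / 2) (plantState a (fun j => θ j (m j))
            (fun s j => pairOutputs (fun l => y l j) s) ((i : ℕ) / 2))).re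
        else
          (π ((i : ℕ) / 2) (plantState a (fun j => θ j (m j))
            (fun s j => pairOutputs (fun l => y l j) s) ((i : ℕ) / 2))).im)
      else 0) ∧
  ∀ (j : Fin k) (y : Fin n → ℝ) (m : Fin (M j)),
    ‖θ j (c.dec j y) - receiverEstimate (a j) (pairOutputs y) (n / 2)‖ ≤
      ‖θ j m - receiverEstimate (a j) (pairOutputs y) (n / 2)‖

/-- The codes given by the fixed control `π`, with suitable message points in the unit square,
achieve the rate vector `r` over the real channel under the power constraint `P`. -/
def ControlAchieves {k : ℕ} (a : Fin k → ℂ) (π : Control k) (P : ℝ) (r : Fin k → ℝ) : Prop :=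
  ∃ (θ : (n : ℕ) → (j : Fin k) → Fin (messageCount n (r j)) → ℂ)
    (c : (n : ℕ) → FeedbackCode k n (fun j => messageCount n (r j))),
    (∀ n j m, θ n j m ∈ Set.Ioo (0 : ℝ) 1 ×ℂ Set.Ioo (0 : ℝ) 1) ∧
    (∀ n, IsControlCode a π (θ n) (c n)) ∧
    Tendsto (fun n => (c n).errorProb) atTop (𝓝 0) ∧
    limsup (fun n => (c n).avgPower) atTop ≤ ENNReal.ofReal P

/-! ### The symmetric case -/

/-- The diagonal entries `a_j = a e^{2 π i (j - 1) / k}`, with `j` counted from `0` here. -/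
noncomputable def symmetricPoles (k : ℕ) (a : ℝ) : Fin k → ℂ := fun j =>
  (a : ℂ) * Complex.exp (2 * Real.pi * Complex.I / (k : ℂ) * ((j : ℕ) : ℂ))

/-- `φ` lies in `[1, k]` and solves `(1 + P φ)^(k-1) = (1 + (P / k) φ (k - φ))^k`. -/
def IsPowerGain (k : ℕ) (P φ : ℝ) : Prop :=
  φ ∈ Set.Icc (1 : ℝ) (k : ℝ) ∧
  (1 + P * φ) ^ (k - 1) = (1 + P / (k : ℝ) * φ * ((k : ℝ) - φ)) ^ k

/-- The sum rate `(1 / 2) log (1 + P φ)`, in bits per transmission. -/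
noncomputable def sumRate (P φ : ℝ) : ℝ := 1 / 2 * Real.logb 2 (1 + P * φ)

end GaussianBC

open GaussianBC

/-! ### Hermitian quadratic forms -/

namespace GaussianBC

open Matrix

variable {k : ℕ}

/-! The Riccati equation becomes linear after inversion. It factors as A'G(A − BC) = G, from which S
= G⁻¹ solves the Stein equation A S A' = S + BB'. For diagonal A this says S_ij (a_i conj(a_j) − 1)
= 1, so there is at most one solution. For poles at a times the k-th roots of unity, S is circulant;
the Fourier matrix diagonalizes it, shows that it is positive definite, and gives tr G = k⁻¹ ∑_{i<k}
(x^(i+1) − x^(−i)) with x = a² (`isStabilizingDARESolution_iff`, `trace_inv_steinMatrix`). This is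
strictly increasing in x, vanishes at x = 1 and is unbounded, so a and P determine each other.
Summing the geometric series gives k P x^(k−1) (x − 1) = (x^k − 1)², which under 1 + Pφ = x^k is the
equation for φ (`isPowerGain_iff`). Hence R = ½ log x^k = k log a.

For the power, E S'GS serves as a potential. Completing the square (`quad_add_sq`) shows that its
increment plus the symbol power is at least tr G in every step, with equality for the LQG control.
Telescoping gives both optimality and the limit tr G, because stabilization bounds the potential.

For the error, the estimation error of receiver j after n steps is exactly a_j^(−n) times coordinate
j of the closed-loop state. In the coordinates Gs the closed loop multiplies coordinate j by the
inverse of conj(a_j), so second moments stay bounded (`exists_secondMoment_le`), while the latest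
noise keeps them at least 1; the exponent is therefore log a. With grid points as messages,
Chebyshev's inequality then gives every rate below log a.

All of this uses only that the noise is white and independent of the past (`WhiteAt`), so it applies
both to the complex system and to the pairs of real transmissions with fixed message points. The
boundary rate follows by spending slightly more power and letting the excess tend to zero along a
diagonal sequence of codes (`achievable_of_forall_gt`). -/

/-- The quadratic form `s ↦ s' H s` of a matrix (its real part). -/
noncomputable def quad (H : Matrix (Fin k) (Fin k) ℂ) (s : Fin k → ℂ) : ℝ :=
  (star s ⬝ᵥ H *ᵥ s).re

theorem quad_nonneg {H : Matrix (Fin k) (Fin k) ℂ} (hH : H.PosSemidef) (s : Fin k → ℂ) :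
    0 ≤ quad H s :=
  hH.re_dotProduct_nonneg s

theorem quad_conjTranspose_mul_self (G : Matrix (Fin k) (Fin k) ℂ) (s : Fin k → ℂ) :
    quad (Gᴴ * G) s = ∑ j, ‖(G *ᵥ s) j‖ ^ 2 := by
  have : star s ⬝ᵥ (Gᴴ * G) *ᵥ s = star (G *ᵥ s) ⬝ᵥ (G *ᵥ s) := by
    rw [← mulVec_mulVec, dotProduct_mulVec, star_mulVec]
  rw [quad, this, dotProduct, Complex.re_sum]
  refine Finset.sum_congr rfl fun j _ => ?_
  rw [Pi.star_apply, RCLike.star_def, Complex.conj_mul', ← Complex.ofReal_pow, Complex.ofReal_re]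

theorem continuous_quad (H : Matrix (Fin k) (Fin k) ℂ) : Continuous (quad H) := by
  unfold quad
  refine Complex.continuous_re.comp ?_
  simp only [dotProduct, mulVec, Pi.star_apply]
  fun_prop

/-- A quadratic form is bounded by a multiple of the squared Euclidean norm. -/
theorem exists_quad_le (H : Matrix (Fin k) (Fin k) ℂ) :
    ∃ c : ℝ, 0 ≤ c ∧ ∀ s, quad H s ≤ c * ∑ j, ‖s j‖ ^ 2 := by
  refine ⟨∑ i, ∑ j, ‖H i j‖, by positivity, fun s => ?_⟩
  have hs : ∀ i, ‖s i‖ ^ 2 ≤ ∑ j, ‖s j‖ ^ 2 := fun i =>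
    Finset.single_le_sum (f := fun j => ‖s j‖ ^ 2) (fun j _ => by positivity) (Finset.mem_univ i)
  calc quad H s ≤ ‖star s ⬝ᵥ H *ᵥ s‖ := Complex.re_le_norm _
    _ ≤ ∑ i, ∑ j, ‖H i j‖ * (‖s i‖ * ‖s j‖) := by
        simp only [dotProduct, mulVec, Finset.mul_sum]
        refine (norm_sum_le _ _).trans (Finset.sum_le_sum fun i _ => ?_)
        refine (norm_sum_le _ _).trans (Finset.sum_le_sum fun j _ => le_of_eq ?_)
        rw [norm_mul, norm_mul, Pi.star_apply, norm_star]
        ring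
    _ ≤ ∑ i, ∑ j, ‖H i j‖ * ∑ j, ‖s j‖ ^ 2 := by
        gcongr with i _ j _
        nlinarith [hs i, hs j, sq_nonneg (‖s i‖ - ‖s j‖)]
    _ = _ := by simp only [Finset.sum_mul]

/-- For invertible `G` the Euclidean norm is bounded by that of `G s`. -/
theorem exists_sum_sq_le_quad {G : Matrix (Fin k) (Fin k) ℂ} (hG : IsUnit G) :
    ∃ c : ℝ, 0 ≤ c ∧ ∀ s, ∑ j, ‖s j‖ ^ 2 ≤ c * quad (Gᴴ * G) s := by
  -- The upper bound for the form of G⁻¹, evaluated at Gs, is the required lower bound at s.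
  obtain ⟨c, hc, h⟩ := exists_quad_le ((G⁻¹)ᴴ * G⁻¹)
  refine ⟨c, hc, fun s => ?_⟩
  have := h (G *ᵥ s)
  rwa [quad_conjTranspose_mul_self, mulVec_mulVec,
    Matrix.nonsing_inv_mul _ ((Matrix.isUnit_iff_isUnit_det _).1 hG), one_mulVec,
    ← quad_conjTranspose_mul_self G] at this

theorem sum_sq_single_le (s : Fin k → ℂ) (j : Fin k) : ‖s j‖ ^ 2 ≤ ∑ i, ‖s i‖ ^ 2 :=
  Finset.single_le_sum (f := fun i => ‖s i‖ ^ 2) (fun i _ => by positivity) (Finset.mem_univ j)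

/-- Makes the recursion for quadratic forms applicable to one coordinate; the trace of this matrix
is the unit noise variance that bounds the mean square error from below. -/
theorem quad_single (j : Fin k) (s : Fin k → ℂ) : quad (Matrix.single j j 1) s = ‖s j‖ ^ 2 := by
  have : (Matrix.single j j (1 : ℂ)) *ᵥ s = Pi.single j (s j) := by
    ext i
    simp [mulVec, dotProduct, Matrix.single_apply, Pi.single_apply, ite_and, eq_comm]
  rw [quad, this, dotProduct_single, Pi.star_apply, RCLike.star_def, Complex.conj_mul',
    ← Complex.ofReal_pow, Complex.ofReal_re]

/-! ### The Riccati equation -/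

/-- The scalar `B' G B + 1`. -/
noncomputable def innovationGain (G : Matrix (Fin k) (Fin k) ℂ) : ℂ := 1 + 1 ⬝ᵥ G *ᵥ 1

theorem conjTranspose_inputMatrix_mul_mul (G : Matrix (Fin k) (Fin k) ℂ) :
    (inputMatrix k)ᴴ * G * inputMatrix k + 1 = diagonal fun _ => innovationGain G := by
  ext i j
  rw [Subsingleton.elim i 0, Subsingleton.elim j 0]
  simp only [Matrix.add_apply, Matrix.mul_apply, conjTranspose_apply, inputMatrix, star_one,
    one_mul, mul_one, one_apply_eq, diagonal_apply_eq, innovationGain, dotProduct, mulVec,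
    Pi.one_apply]
  rw [add_comm, Finset.sum_comm]

theorem innovationGain_re {G : Matrix (Fin k) (Fin k) ℂ} (hG : G.PosDef) :
    ∃ β : ℝ, 0 < β ∧ innovationGain G = β := by
  have h := hG.posSemidef.dotProduct_mulVec_nonneg 1
  rw [star_one] at h
  refine ⟨1 + (1 ⬝ᵥ G *ᵥ 1 : ℂ).re, ?_, ?_⟩
  · have := (Complex.le_def.1 h).1
    simp only [Complex.zero_re] at this
    linarith
  · rw [innovationGain, Complex.ofReal_add, Complex.ofReal_one]
    congr 1
    have := (Complex.le_def.1 h).2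
    exact Complex.ext (by simp) (by simpa using this.symm)

/-- The symbol `C s`. -/
noncomputable def gainDot (a : Fin k → ℂ) (G : Matrix (Fin k) (Fin k) ℂ) (s : Fin k → ℂ) : ℂ :=
  ∑ j, lqgGain a G 0 j * s j

/-- The definition of C cleared of its denominator. Positive definiteness makes the scalar B'GB + 1
positive, so the inverse of the 1 × 1 matrix is a genuine one. -/
theorem innovationGain_mul_gainDot {G : Matrix (Fin k) (Fin k) ℂ} (hG : G.PosDef)
    (a s : Fin k → ℂ) :
    innovationGain G * gainDot a G s = 1 ⬝ᵥ G *ᵥ (diagonal a *ᵥ s) := by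
  obtain ⟨β, hβ, hGβ⟩ := innovationGain_re hG
  have hne : innovationGain G ≠ 0 := by
    rw [hGβ]; exact_mod_cast hβ.ne'
  have hC : ∀ j, innovationGain G * lqgGain a G 0 j = (∑ i, G i j) * a j := by
    intro j
    rw [lqgGain, conjTranspose_inputMatrix_mul_mul, inv_subsingleton, diagonal_mul,
      diagonal_apply_eq, Ring.inverse_eq_inv', mul_inv_cancel_left₀ hne, mul_diagonal,
      Matrix.mul_apply]
    simp [inputMatrix]
  have hv : diagonal a *ᵥ s = fun j => a j * s j := funext fun j => mulVec_diagonal a s j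
  rw [gainDot, Finset.mul_sum, hv]
  simp only [← mul_assoc, hC]
  simp only [dotProduct, Pi.one_apply, one_mul, mulVec]
  rw [Finset.sum_comm]
  refine Finset.sum_congr rfl fun j _ => ?_
  rw [mul_assoc, Finset.sum_mul]

theorem closed_loop_mulVec (a : Fin k → ℂ) (G : Matrix (Fin k) (Fin k) ℂ) (s : Fin k → ℂ) :
    (diagonal a - inputMatrix k * lqgGain a G) *ᵥ s =
      diagonal a *ᵥ s - gainDot a G s • (1 : Fin k → ℂ) := by
  rw [sub_mulVec]
  congr 1
  ext i
  simp [mulVec, dotProduct, Matrix.mul_apply, inputMatrix, gainDot]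

namespace IsStabilizingDARESolution

variable {a : Fin k → ℂ} {G : Matrix (Fin k) (Fin k) ℂ}

/-- Substituting C into the Riccati equation factors its right side as A'G(A − BC). This is the form
in which the equation is used for a given solution. -/
theorem conjTranspose_mul_mul_closedLoop (h : IsStabilizingDARESolution a G) :
    (diagonal a)ᴴ * G * (diagonal a - inputMatrix k * lqgGain a G) = G := by
  rw [Matrix.mul_sub, lqgGain]
  conv_rhs => rw [h.2.1]
  simp only [Matrix.mul_assoc]

/-- As A' is diagonal, the factored Riccati equation decouples: in the coordinates Gs the closed
loop divides coordinate j by conj(a_j). -/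
theorem conj_mul_mulVec (h : IsStabilizingDARESolution a G) (s : Fin k → ℂ) (j : Fin k) :
    conj (a j) * (G *ᵥ ((diagonal a - inputMatrix k * lqgGain a G) *ᵥ s)) j = (G *ᵥ s) j := by
  conv_rhs => rw [← h.conjTranspose_mul_mul_closedLoop]
  rw [← mulVec_mulVec, ← mulVec_mulVec, diagonal_conjTranspose, mulVec_diagonal]
  rfl

/-- Completing the square. -/
theorem quad_add_sq (h : IsStabilizingDARESolution a G) (s : Fin k → ℂ) (x : ℂ) :
    quad G (diagonal a *ᵥ s + x • 1) + ‖x‖ ^ 2 =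
      quad G s + (innovationGain G).re * ‖x + gainDot a G s‖ ^ 2 := by
  obtain ⟨β, hβ, hGβ⟩ := innovationGain_re h.1
  set c := gainDot a G s with hc
  set v := diagonal a *ᵥ s with hv
  have h1 : (1 : Fin k → ℂ) ⬝ᵥ G *ᵥ v = β * c := by
    rw [← hGβ, innovationGain_mul_gainDot h.1]
  have h2 : star v ⬝ᵥ G *ᵥ 1 = β * conj c := by
    have : star ((1 : Fin k → ℂ) ⬝ᵥ G *ᵥ v) = star v ⬝ᵥ G *ᵥ 1 := by
      rw [star_dotProduct, star_mulVec, h.1.isHermitian.eq, star_one, dotProduct_mulVec]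
    rw [← this, h1, RCLike.star_def, map_mul, Complex.conj_ofReal]
  have h3 : (1 : Fin k → ℂ) ⬝ᵥ G *ᵥ 1 = β - 1 := by
    rw [← hGβ, innovationGain]; ring
  -- The Riccati equation enters only here; the rest of the identity is expansion of the quadratic
  -- form at v + x·1.
  have h4 : star s ⬝ᵥ G *ᵥ s = star v ⬝ᵥ G *ᵥ v - c * (β * conj c) := by
    conv_lhs => rw [← h.conjTranspose_mul_mul_closedLoop]
    rw [← mulVec_mulVec, closed_loop_mulVec, ← mulVec_mulVec, dotProduct_mulVec, ← star_mulVec,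
      mulVec_sub, dotProduct_sub, mulVec_smul, dotProduct_smul, h2]
    rfl
  have hn : ∀ z : ℂ, ‖z‖ ^ 2 = (conj z * z).re := fun z => by
    rw [Complex.conj_mul', ← Complex.ofReal_pow, Complex.ofReal_re]
  rw [quad, quad, h4, hn, hn, hGβ, Complex.ofReal_re, ← Complex.re_ofReal_mul, ← Complex.add_re,
    ← Complex.add_re]
  congr 1
  rw [star_add, star_smul, star_one, mulVec_add, mulVec_smul, dotProduct_add, add_dotProduct,
    add_dotProduct, dotProduct_smul, dotProduct_smul, smul_dotProduct, smul_dotProduct, h1, h2, h3,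
    RCLike.star_def, map_add]
  simp only [smul_eq_mul]
  ring

/-- The state `G s` contracts by the factor `1 / ‖a_j‖` in each coordinate. -/
theorem quad_closedLoop (h : IsStabilizingDARESolution a G) {α : ℝ} (hα : 0 < α)
    (ha : ∀ j, ‖a j‖ = α) (s : Fin k → ℂ) :
    quad (Gᴴ * G) (diagonal a *ᵥ s - gainDot a G s • (1 : Fin k → ℂ)) =
      (α ^ 2)⁻¹ * quad (Gᴴ * G) s := by
  rw [← closed_loop_mulVec, quad_conjTranspose_mul_self, quad_conjTranspose_mul_self,
    Finset.mul_sum]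
  refine Finset.sum_congr rfl fun j _ => ?_
  have := congrArg (‖·‖ ^ 2) (h.conj_mul_mulVec s j)
  simp only [norm_mul, RCLike.norm_conj, ha, mul_pow] at this
  rw [← this, inv_mul_cancel_left₀ (by positivity)]

end IsStabilizingDARESolution

end GaussianBC

/-! ### The Stein equation and the explicit Riccati solution -/

namespace GaussianBC

open Matrix

variable {k : ℕ}

/-- The inverse of a positive definite Riccati solution solves a Stein equation. -/
theorem IsStabilizingDARESolution.stein {a : Fin k → ℂ} {G : Matrix (Fin k) (Fin k) ℂ}
    (h : IsStabilizingDARESolution a G) :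
    diagonal a * G⁻¹ * (diagonal a)ᴴ = G⁻¹ + inputMatrix k * (inputMatrix k)ᴴ := by
  obtain ⟨β, hβ, hGβ⟩ := innovationGain_re h.1
  have hGu : IsUnit G.det := (Matrix.isUnit_iff_isUnit_det _).1 h.1.isUnit
  have hne : innovationGain G ≠ 0 := by
    rw [hGβ]; exact_mod_cast hβ.ne'
  set A := diagonal a
  set B := inputMatrix k
  set C := lqgGain a G with hC
  set N := Bᴴ * G * B + 1 with hN
  have hNu : IsUnit N.det := by
    rw [hN, conjTranspose_inputMatrix_mul_mul, det_fin_one]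
    simpa using hne
  have hD := h.conjTranspose_mul_mul_closedLoop
  have h1 : Aᴴ * (G * (A - B * C) * G⁻¹) = 1 := by
    rw [← Matrix.mul_assoc, ← Matrix.mul_assoc, hD, mul_nonsing_inv _ hGu]
  have h2 : A * G⁻¹ * Aᴴ - B * (C * G⁻¹ * Aᴴ) = G⁻¹ := by
    -- A one-sided inverse of a square matrix is two-sided, so A' may be moved to the right end.
    have h3 := mul_eq_one_comm.1 h1
    have h4 : G⁻¹ * (G * (A - B * C) * G⁻¹ * Aᴴ) = G⁻¹ := by rw [h3, Matrix.mul_one]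
    rw [Matrix.mul_assoc, Matrix.mul_assoc, nonsing_inv_mul_cancel_left _ _ hGu] at h4
    conv_rhs => rw [← h4]
    rw [Matrix.sub_mul]
    simp only [Matrix.mul_assoc]
  have hNC : N * C = Bᴴ * G * A := by
    rw [hC, lqgGain, mul_nonsing_inv_cancel_left _ _ hNu]
  -- For X = C G⁻¹ A', the definition of C and `h2` give (B'GB + 1) X = B' + B'GB X, and B'GB X
  -- cancels.
  have h5 : C * G⁻¹ * Aᴴ = Bᴴ := by
    have e1 : N * (C * G⁻¹ * Aᴴ) = Bᴴ * G * (A * G⁻¹ * Aᴴ) := by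
      simp only [← Matrix.mul_assoc, hNC]
    rw [sub_eq_iff_eq_add.1 h2, Matrix.mul_add, mul_nonsing_inv_cancel_right _ _ hGu, hN,
      Matrix.add_mul, Matrix.one_mul, ← Matrix.mul_assoc (Bᴴ * G) B, add_comm] at e1
    exact add_right_cancel e1
  rw [sub_eq_iff_eq_add.1 h2, h5]

/-- The Stein equation read entry by entry. The product being 1 makes the second factor nonzero, so
each entry of G⁻¹ is determined: this is the uniqueness of G. -/
theorem IsStabilizingDARESolution.inv_apply {a : Fin k → ℂ} {G : Matrix (Fin k) (Fin k) ℂ}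
    (h : IsStabilizingDARESolution a G) (i j : Fin k) :
    G⁻¹ i j * (a i * conj (a j) - 1) = 1 := by
  have := congrFun (congrFun h.stein i) j
  rw [diagonal_conjTranspose, mul_diagonal, diagonal_mul] at this
  simp only [Matrix.add_apply, Matrix.mul_apply, inputMatrix, conjTranspose_apply, star_one,
    Pi.star_apply, RCLike.star_def, mul_one, Finset.sum_const, Finset.card_univ, Fintype.card_fin,
    one_smul] at this
  linear_combination this

/-- If Dv = μv, then w = Gv satisfies conj(a_j) μ w_j = w_j for every j. Some w_j is nonzero, so μ
is the inverse of some conj(a_j). -/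
theorem norm_lt_one_of_mem_spectrum_closedLoop {a : Fin k → ℂ} {G D : Matrix (Fin k) (Fin k) ℂ}
    (ha : ∀ j, 1 < ‖a j‖) (hG : IsUnit G.det) (hD : (diagonal a)ᴴ * G * D = G) :
    ∀ μ ∈ spectrum ℂ D, ‖μ‖ < 1 := by
  intro μ hμ
  rw [spectrum.mem_iff, Matrix.isUnit_iff_isUnit_det, isUnit_iff_ne_zero, not_not,
    ← exists_mulVec_eq_zero_iff] at hμ
  obtain ⟨v, hv, hDv⟩ := hμ
  have hDv' : D *ᵥ v = μ • v := by
    rw [sub_mulVec, sub_eq_zero, Algebra.algebraMap_eq_smul_one, smul_mulVec, one_mulVec] at hDv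
    exact hDv.symm
  have hw : G *ᵥ v ≠ 0 := fun h0 =>
    (isUnit_iff_ne_zero.1 hG) (exists_mulVec_eq_zero_iff.1 ⟨v, hv, h0⟩)
  obtain ⟨j, hj⟩ := Function.ne_iff.1 hw
  have e : conj (a j) * (μ * (G *ᵥ v) j) = (G *ᵥ v) j := by
    conv_rhs => rw [← hD]
    rw [← mulVec_mulVec, hDv', ← mulVec_mulVec, diagonal_conjTranspose, mulVec_diagonal,
      mulVec_smul]
    rfl
  have e1 : conj (a j) * μ = 1 := by
    refine mul_right_cancel₀ hj ?_
    rw [one_mul, mul_assoc, e]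
  have e2 : ‖a j‖ * ‖μ‖ = 1 := by
    rw [← RCLike.norm_conj (a j), ← norm_mul, e1, norm_one]
  nlinarith [ha j, norm_nonneg μ]

/-- A positive definite solution of the Stein equation gives a stabilizing Riccati solution. -/
theorem isStabilizingDARESolution_inv {a : Fin k → ℂ} {S : Matrix (Fin k) (Fin k) ℂ}
    (ha : ∀ j, 1 < ‖a j‖) (hS : S.PosDef)
    (h : diagonal a * S * (diagonal a)ᴴ = S + inputMatrix k * (inputMatrix k)ᴴ) :
    IsStabilizingDARESolution a S⁻¹ := by
  obtain ⟨β, hβ, hGβ⟩ := innovationGain_re hS.inv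
  have hne : innovationGain S⁻¹ ≠ 0 := by
    rw [hGβ]; exact_mod_cast hβ.ne'
  have hSu : IsUnit S.det := (Matrix.isUnit_iff_isUnit_det _).1 hS.isUnit
  have hAu : IsUnit (diagonal a)ᴴ.det := by
    rw [det_conjTranspose, det_diagonal, isUnit_iff_ne_zero, star_ne_zero, Finset.prod_ne_zero_iff]
    intro j _ h0
    have := ha j
    rw [h0, norm_zero] at this
    linarith
  set G := S⁻¹ with hG
  have hGu : IsUnit G.det := (Matrix.isUnit_iff_isUnit_det _).1 hS.inv.isUnit
  set A := diagonal a with hA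
  set B := inputMatrix k with hB
  set N := Bᴴ * G * B + 1 with hN
  have hNu : IsUnit N.det := by
    rw [hN, conjTranspose_inputMatrix_mul_mul, det_fin_one]
    simpa using hne
  have hSG : S * G = 1 := mul_nonsing_inv _ hSu
  have hGS : G * S = 1 := nonsing_inv_mul _ hSu
  -- A'GD = G forces this value of the closed-loop matrix. The row y is then shown to be C: the
  -- Stein equation gives D + By = A, and multiplying by B'G gives (B'GB + 1) y = B'GA.
  set D := S * (Aᴴ)⁻¹ * G with hD
  set y := Bᴴ * G * D with hy
  have h1 : D + B * y = A := by
    have : D + B * y = (S + B * Bᴴ) * (Aᴴ)⁻¹ * G := by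
      have : B * y = B * Bᴴ * (G * S) * (Aᴴ)⁻¹ * G := by
        rw [hy, hD]; simp only [Matrix.mul_assoc]
      rw [this, hGS, hD]
      noncomm_ring
    rw [this, ← h, mul_nonsing_inv_cancel_right _ _ hAu, Matrix.mul_assoc, hSG, Matrix.mul_one]
  have h2 : N * y = Bᴴ * G * A := by
    rw [← h1, hN, Matrix.mul_add, Matrix.add_mul, Matrix.one_mul, ← hy, add_comm,
      ← Matrix.mul_assoc (Bᴴ * G)]
  have h3 : y = lqgGain a G := by
    rw [lqgGain, ← hA, ← hB, ← hN, ← h2, nonsing_inv_mul_cancel_left _ _ hNu]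
  have h4 : A - B * lqgGain a G = D := by
    rw [← h3, ← h1, add_sub_cancel_right]
  have h5 : Aᴴ * G * D = G := by
    have : Aᴴ * G * D = Aᴴ * (G * S) * (Aᴴ)⁻¹ * G := by
      rw [hD]; simp only [Matrix.mul_assoc]
    rw [this, hGS, Matrix.mul_one, mul_nonsing_inv _ hAu, Matrix.one_mul]
  refine ⟨hS.inv, ?_, ?_⟩
  · conv_lhs => rw [← h5, ← h4, Matrix.mul_sub, lqgGain]
    simp only [Matrix.mul_assoc]
    rfl
  · rw [← hA, ← hB, h4]
    exact norm_lt_one_of_mem_spectrum_closedLoop ha hGu h5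

/-! ### The symmetric case -/

/-- The root of unity `e^{2 π i j / k}`. -/
noncomputable def phase (k : ℕ) (j : Fin k) : ℂ :=
  Complex.exp (2 * Real.pi * Complex.I / (k : ℂ)) ^ (j : ℕ)

theorem symmetricPoles_eq (k : ℕ) (a : ℝ) (j : Fin k) : symmetricPoles k a j = a * phase k j := by
  rw [symmetricPoles, phase, ← Complex.exp_nat_mul, mul_comm (((j : ℕ) : ℂ))]

theorem phase_pow (j : Fin k) : phase k j ^ k = 1 := by
  have hk : k ≠ 0 := j.pos.ne'
  rw [phase, pow_right_comm, (Complex.isPrimitiveRoot_exp k hk).pow_eq_one, one_pow]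

theorem norm_phase (j : Fin k) : ‖phase k j‖ = 1 := by
  have hk : k ≠ 0 := j.pos.ne'
  exact Complex.norm_eq_one_of_pow_eq_one (phase_pow j) hk

theorem phase_injective : Function.Injective (phase k) := fun i j h => by
  have hk : k ≠ 0 := i.pos.ne'
  exact Fin.ext ((Complex.isPrimitiveRoot_exp k hk).pow_inj i.2 j.2 h)

theorem conj_phase_mul (j : Fin k) : conj (phase k j) * phase k j = 1 := by
  rw [Complex.conj_mul', norm_phase]; simp

theorem norm_symmetricPoles {a : ℝ} (ha : 0 ≤ a) (j : Fin k) : ‖symmetricPoles k a j‖ = a := by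
  rw [symmetricPoles_eq, norm_mul, norm_phase, mul_one, Complex.norm_real, Real.norm_of_nonneg ha]

theorem sum_pow_succ {y : ℂ} (hy : y ^ k = 1) (hy1 : y ≠ 1) :
    ∑ r : Fin k, y ^ ((r : ℕ) + 1) = 0 := by
  rw [Fin.sum_univ_eq_sum_range (fun r => y ^ (r + 1)) k]
  simp only [pow_succ, ← Finset.sum_mul]
  rw [geom_sum_eq hy1, hy, sub_self, zero_div, zero_mul]

/-- The discrete Fourier matrix. -/
noncomputable def fourier (k : ℕ) : Matrix (Fin k) (Fin k) ℂ :=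
  fun j r => conj (phase k j) ^ ((r : ℕ) + 1)

/-- The entries depend only on the ratio of two roots of unity, so these matrices are circulant.
With d = 1 this is the orthogonality of characters, with geometric d the solution of the Stein
equation. -/
theorem fourier_mul_diagonal_mul_apply (d : Fin k → ℂ) (i j : Fin k) :
    (fourier k * diagonal d * (fourier k)ᴴ) i j =
      ∑ r : Fin k, d r * (conj (phase k i) * phase k j) ^ ((r : ℕ) + 1) := by
  rw [Matrix.mul_apply]
  refine Finset.sum_congr rfl fun r _ => ?_
  rw [mul_diagonal, conjTranspose_apply, fourier, fourier, RCLike.star_def, map_pow,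
    Complex.conj_conj, mul_pow]
  ring

theorem fourier_mul_conjTranspose (hk : k ≠ 0) :
    fourier k * ((k : ℂ)⁻¹ • (fourier k)ᴴ) = 1 := by
  have hk' : (k : ℂ) ≠ 0 := by exact_mod_cast hk
  have h := fourier_mul_diagonal_mul_apply (k := k) 1
  rw [show diagonal (1 : Fin k → ℂ) = 1 from diagonal_one, Matrix.mul_one] at h
  ext i j
  rw [Matrix.mul_smul, Matrix.smul_apply, h]
  simp only [Pi.one_apply, one_mul]
  rcases eq_or_ne i j with rfl | hij
  · simp [conj_phase_mul, hk']
  · have h1 : conj (phase k i) * phase k j ≠ 1 := fun h0 => hij <| phase_injective <| by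
      have := congrArg (phase k i * ·) h0
      simp only [← mul_assoc, mul_one] at this
      rw [mul_comm (phase k i), conj_phase_mul, one_mul] at this
      exact this.symm
    rw [sum_pow_succ _ h1, smul_zero, one_apply_ne hij]
    rw [mul_pow, ← map_pow, phase_pow, phase_pow, map_one, one_mul]

theorem isUnit_fourier (hk : k ≠ 0) : IsUnit (fourier k) :=
  IsUnit.of_mul_eq_one _ (fourier_mul_conjTranspose hk)

/-- The coefficients of the circulant solution of the Stein equation. -/
noncomputable def steinCoeff (k : ℕ) (a : ℝ) (r : Fin k) : ℝ :=
  (1 - ((a ^ 2)⁻¹) ^ k)⁻¹ * ((a ^ 2)⁻¹) ^ ((r : ℕ) + 1)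

theorem inv_sq_pow_lt_one {a : ℝ} (ha : 1 < a) (hk : k ≠ 0) : ((a ^ 2)⁻¹) ^ k < 1 :=
  pow_lt_one₀ (by positivity) (inv_lt_one_of_one_lt₀ (one_lt_pow₀ ha two_ne_zero)) hk

theorem steinCoeff_pos {a : ℝ} (ha : 1 < a) (r : Fin k) : 0 < steinCoeff k a r := by
  have hk : k ≠ 0 := r.pos.ne'
  have := inv_sq_pow_lt_one ha hk
  unfold steinCoeff
  have h1 : 0 < 1 - ((a ^ 2)⁻¹) ^ k := by linarith
  positivity

/-- The circulant solution of the Stein equation. -/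
noncomputable def steinMatrix (k : ℕ) (a : ℝ) : Matrix (Fin k) (Fin k) ℂ :=
  fourier k * diagonal (fun r => (steinCoeff k a r : ℂ)) * (fourier k)ᴴ

theorem steinMatrix_posDef {a : ℝ} (ha : 1 < a) (hk : k ≠ 0) : (steinMatrix k a).PosDef := by
  refine PosDef.mul_mul_conjTranspose_same (posDef_diagonal_iff.2 fun r => ?_)
    (vecMul_injective_iff_isUnit.2 (isUnit_fourier hk))
  exact_mod_cast steinCoeff_pos ha r

/-- With x the inverse of a_i conj(a_j), the required entry is x/(1 − x) = ∑_{m≥1} x^m. The phase of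
x has order dividing k, so the series folds into the exponents 1, …, k with weights a^(−2m)/(1 −
a^(−2k)); this is where the coefficients, and the exponents starting at 1, come from. -/
theorem steinMatrix_apply {a : ℝ} (ha : 1 < a) (i j : Fin k) :
    steinMatrix k a i j * (symmetricPoles k a i * conj (symmetricPoles k a j) - 1) = 1 := by
  have hk : k ≠ 0 := i.pos.ne'
  have ha0 : (a : ℂ) ≠ 0 := by exact_mod_cast (by linarith : a ≠ 0)
  set y := conj (phase k i) * phase k j with hy
  have hyk : y ^ k = 1 := by
    rw [mul_pow, ← map_pow, phase_pow, phase_pow, map_one, one_mul]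
  have hy0 : y * (phase k i * conj (phase k j)) = 1 := by
    have := congrArg₂ (· * ·) (conj_phase_mul i) (conj_phase_mul j)
    simp only [mul_one] at this
    rw [← this, hy]
    ring
  set x : ℂ := ((a ^ 2)⁻¹ : ℝ) * y with hx
  have hx1 : x ≠ 1 := fun h0 => by
    have := congrArg (‖·‖) h0
    simp only [hx, hy, norm_mul, RCLike.norm_conj, norm_phase, mul_one, norm_one,
      Complex.norm_real] at this
    rw [Real.norm_of_nonneg (by positivity)] at this
    have := inv_sq_pow_lt_one ha one_ne_zero
    rw [pow_one] at this
    linarith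
  have hsum : steinMatrix k a i j = (1 - ((((a ^ 2)⁻¹ : ℝ) : ℂ)) ^ k)⁻¹ *
      (x * ∑ r ∈ Finset.range k, x ^ r) := by
    rw [steinMatrix, fourier_mul_diagonal_mul_apply, ← hy, Finset.mul_sum, Finset.mul_sum,
      ← Fin.sum_univ_eq_sum_range
        (fun r => (1 - ((((a ^ 2)⁻¹ : ℝ) : ℂ)) ^ k)⁻¹ * (x * x ^ r)) k]
    refine Finset.sum_congr rfl fun r _ => ?_
    rw [steinCoeff, ← pow_succ', hx, mul_pow]
    push_cast
    ring
  have hxk : x ^ k = (((a ^ 2)⁻¹ : ℝ) : ℂ) ^ k := by rw [hx, mul_pow, hyk, mul_one]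
  have hne : (1 - x ^ k : ℂ) ≠ 0 := by
    rw [hxk]
    have := inv_sq_pow_lt_one ha hk
    exact_mod_cast (by linarith : (1 - ((a ^ 2)⁻¹) ^ k) ≠ 0)
  have hp : x * (symmetricPoles k a i * conj (symmetricPoles k a j)) = 1 := by
    rw [symmetricPoles_eq, symmetricPoles_eq, map_mul, Complex.conj_ofReal, hx]
    have : ((((a ^ 2)⁻¹ : ℝ) : ℂ)) * (a * a) = 1 := by
      push_cast
      field_simp
    calc _ = (((((a ^ 2)⁻¹ : ℝ) : ℂ)) * (a * a)) * (y * (phase k i * conj (phase k j))) := by ring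
      _ = 1 := by rw [this, hy0, one_mul]
  rw [hsum, ← hxk]
  have hg := geom_sum_mul x k
  have : (x * ∑ r ∈ Finset.range k, x ^ r) *
      (symmetricPoles k a i * conj (symmetricPoles k a j) - 1) = 1 - x ^ k := by
    linear_combination (∑ r ∈ Finset.range k, x ^ r) * hp - hg
  rw [mul_assoc, this, inv_mul_cancel₀ hne]

theorem steinMatrix_stein {a : ℝ} (ha : 1 < a) :
    diagonal (symmetricPoles k a) * steinMatrix k a * (diagonal (symmetricPoles k a))ᴴ =
      steinMatrix k a + inputMatrix k * (inputMatrix k)ᴴ := by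
  ext i j
  rw [diagonal_conjTranspose, mul_diagonal, diagonal_mul]
  simp only [Matrix.add_apply, Matrix.mul_apply, inputMatrix, conjTranspose_apply, star_one,
    Pi.star_apply, RCLike.star_def, mul_one, Finset.sum_const, Finset.card_univ, Fintype.card_fin,
    one_smul]
  linear_combination steinMatrix_apply ha i j

/-- Uniqueness compares the entries of G⁻¹ with those of the circulant matrix; existence inverts the
explicit Stein solution. -/
theorem isStabilizingDARESolution_iff {a : ℝ} (ha : 1 < a) (hk : k ≠ 0)
    {G : Matrix (Fin k) (Fin k) ℂ} :
    IsStabilizingDARESolution (symmetricPoles k a) G ↔ G = (steinMatrix k a)⁻¹ := by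
  have hn : ∀ j, 1 < ‖symmetricPoles k a j‖ := fun j => by
    rwa [norm_symmetricPoles (by linarith)]
  constructor
  · intro h
    have : G⁻¹ = steinMatrix k a := by
      ext i j
      have h1 := h.inv_apply i j
      have h2 := steinMatrix_apply ha i j
      exact mul_right_cancel₀ (right_ne_zero_of_mul_eq_one h1) (h1.trans h2.symm)
    rw [← this, nonsing_inv_nonsing_inv _ ((Matrix.isUnit_iff_isUnit_det _).1 h.1.isUnit)]
  · rintro rfl
    exact isStabilizingDARESolution_inv hn (steinMatrix_posDef ha hk) (steinMatrix_stein ha)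

/-- The power of the symmetric LQG control with `a ^ 2 = x`. -/
noncomputable def lqgPower (k : ℕ) (x : ℝ) : ℝ :=
  (k : ℝ)⁻¹ * ∑ i ∈ Finset.range k, (x ^ (i + 1) - (x ^ i)⁻¹)

/-- The Fourier matrix is √k times a unitary one, so the inverse is again circulant, with
coefficients `d`. Every diagonal entry is their sum, and the trace is k⁻¹ times the sum of the
inverse Stein coefficients. -/
theorem trace_inv_steinMatrix {a : ℝ} (ha : 1 < a) (hk : k ≠ 0) :
    (steinMatrix k a)⁻¹.trace.re = lqgPower k (a ^ 2) := by
  have hkC : (k : ℂ) ≠ 0 := by exact_mod_cast hk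
  have hkR : (k : ℝ) ≠ 0 := by exact_mod_cast hk
  have hF := mul_eq_one_comm.1 (fourier_mul_conjTranspose hk)
  set d : Fin k → ℝ := fun r => ((k : ℝ)⁻¹) ^ 2 * (steinCoeff k a r)⁻¹ with hd
  have hinv : (steinMatrix k a)⁻¹ =
      fourier k * diagonal (fun r => (d r : ℂ)) * (fourier k)ᴴ := by
    refine inv_eq_right_inv ?_
    have h1 : (fourier k)ᴴ * fourier k = (k : ℂ) • 1 := by
      rw [← hF, smul_mul_assoc, smul_smul, mul_inv_cancel₀ hkC, one_smul]
    have h2 : fourier k * (fourier k)ᴴ = (k : ℂ) • 1 := by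
      rw [← fourier_mul_conjTranspose hk, mul_smul_comm, smul_smul, mul_inv_cancel₀ hkC, one_smul]
    calc _ = fourier k * diagonal (fun r => (steinCoeff k a r : ℂ)) *
          ((fourier k)ᴴ * fourier k) * diagonal (fun r => (d r : ℂ)) * (fourier k)ᴴ := by
          rw [steinMatrix]; simp only [Matrix.mul_assoc]
      _ = (k : ℂ) • (fourier k * (diagonal (fun r => (steinCoeff k a r : ℂ)) *
            diagonal (fun r => (d r : ℂ))) * (fourier k)ᴴ) := by
          rw [h1]
          simp only [mul_smul_comm, smul_mul_assoc, Matrix.mul_one, Matrix.mul_assoc]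
      _ = 1 := by
          have : (fun r => (steinCoeff k a r : ℂ) * (d r : ℂ)) = fun _ => ((k : ℂ)⁻¹) ^ 2 := by
            funext r
            have := (steinCoeff_pos ha r).ne'
            have e : steinCoeff k a r * d r = ((k : ℝ)⁻¹) ^ 2 := by
              rw [hd]; field_simp
            rw [← Complex.ofReal_mul, e]
            push_cast
            rfl
          rw [diagonal_mul_diagonal, this, ← smul_one_eq_diagonal, mul_smul_comm, smul_mul_assoc,
            Matrix.mul_one, h2, smul_smul, smul_smul]
          rw [show (k : ℂ) * ((k : ℂ)⁻¹) ^ 2 * k = 1 by field_simp, one_smul]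
  have hdiag : ∀ j, ((steinMatrix k a)⁻¹ j j).re = ∑ r, d r := by
    intro j
    rw [hinv, fourier_mul_diagonal_mul_apply, conj_phase_mul]
    simp only [one_pow, mul_one]
    rw [← Complex.ofReal_sum, Complex.ofReal_re]
  rw [trace, Complex.re_sum]
  simp only [diag_apply, hdiag]
  rw [Finset.sum_const, Finset.card_univ, Fintype.card_fin, nsmul_eq_mul, lqgPower, hd,
    ← Finset.mul_sum]
  have hlt := inv_sq_pow_lt_one ha hk
  have ha0 : (0 : ℝ) < a ^ 2 := by positivity
  generalize hx : a ^ 2 = x at hlt ha0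
  have hne : 1 - (x⁻¹) ^ k ≠ 0 := by linarith
  have hx0 : x ≠ 0 := ha0.ne'
  -- Each inverse coefficient is x^(r+1) − x^(r+1−k); reversing the order of the second terms turns
  -- their exponents into −i.
  have key : ∑ r, (steinCoeff k a r)⁻¹ =
      ∑ i ∈ Finset.range k, (x ^ (i + 1) - (x ^ i)⁻¹) := by
    simp only [steinCoeff, hx]
    rw [Fin.sum_univ_eq_sum_range (fun r => ((1 - x⁻¹ ^ k)⁻¹ * x⁻¹ ^ (r + 1))⁻¹) k,
      Finset.sum_sub_distrib, ← Finset.sum_range_reflect (fun i => (x ^ i)⁻¹),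
      ← Finset.sum_sub_distrib]
    refine Finset.sum_congr rfl fun i hi => ?_
    have hik : i + 1 ≤ k := Finset.mem_range.1 hi
    rw [mul_inv, inv_inv, inv_pow x, inv_pow x, inv_inv, sub_mul, one_mul]
    congr 1
    rw [show k - 1 - i = k - (i + 1) by omega]
    have : x ^ k = x ^ (k - (i + 1)) * x ^ (i + 1) := by rw [← pow_add]; congr 1; omega
    rw [this]
    field_simp
  rw [key]
  field_simp

end GaussianBC

namespace GaussianBC

open Matrix

variable {k : ℕ}

/-! ### White noise -/

/-- A law on `ℂ^k` with mean zero and identity covariance. -/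
structure IsWhite (ν : Measure (Fin k → ℂ)) : Prop where
  memLp : ∀ j, MemLp (fun z => z j) 2 ν
  mean : ∀ j, ∫ z, z j ∂ν = 0
  cov : ∀ i j, ∫ z, conj (z i) * z j ∂ν = if i = j then 1 else 0

namespace IsWhite

variable {ν : Measure (Fin k → ℂ)} [IsProbabilityMeasure ν]

/-- Expand the form: the terms linear in z vanish since the mean is zero, and the identity
covariance leaves only the diagonal of H from the terms quadratic in z. -/
theorem quad_add (hν : IsWhite ν) (H : Matrix (Fin k) (Fin k) ℂ) (v : Fin k → ℂ) :
    Integrable (fun z => quad H (v + z)) ν ∧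
      ∫ z, quad H (v + z) ∂ν = quad H v + H.trace.re := by
  have hint : ∀ j, Integrable (fun z : Fin k → ℂ => z j) ν := fun j =>
    (hν.memLp j).integrable one_le_two
  have hconj : ∀ j, Integrable (fun z : Fin k → ℂ => conj (z j)) ν := fun j =>
    (hν.memLp j).star.integrable one_le_two
  have hmul : ∀ i j, Integrable (fun z : Fin k → ℂ => conj (z i) * z j) ν := fun i j =>
    (hν.memLp i).star.integrable_mul (hν.memLp j)
  have hcm : ∀ j, ∫ z, conj (z j) ∂ν = 0 := fun j => by
    rw [integral_conj, hν.mean, map_zero]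
  set f : Fin k → Fin k → (Fin k → ℂ) → ℂ := fun i j z =>
    conj (v i) * H i j * v j + (conj (v i) * H i j * z j + (H i j * v j * conj (z i) +
      H i j * (conj (z i) * z j))) with hf
  have hfi : ∀ i j, Integrable (f i j) ν := fun i j =>
    (integrable_const _).add (((hint j).const_mul _).add
      (((hconj i).const_mul _).add ((hmul i j).const_mul _)))
  have hq : ∀ z, quad H (v + z) = (∑ i, ∑ j, f i j z).re := by
    intro z
    rw [quad]
    congr 1
    simp only [dotProduct, mulVec, Finset.mul_sum, hf, Pi.star_apply, Pi.add_apply, star_add,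
      RCLike.star_def]
    refine Finset.sum_congr rfl fun i _ => Finset.sum_congr rfl fun j _ => ?_
    ring
  have hI : Integrable (fun z => ∑ i, ∑ j, f i j z) ν :=
    integrable_finsetSum _ fun i _ => integrable_finsetSum _ fun j _ => hfi i j
  simp only [hq]
  refine ⟨hI.re, ?_⟩
  have h1 : ∫ z, (∑ i, ∑ j, f i j z).re ∂ν = (∫ z, ∑ i, ∑ j, f i j z ∂ν).re := integral_re hI
  rw [h1, integral_finsetSum _ fun i _ => integrable_finsetSum _ fun j _ => hfi i j]
  have h2 : ∀ i, ∫ z, ∑ j, f i j z ∂ν =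
      ∑ j, conj (v i) * H i j * v j + H i i := by
    intro i
    rw [integral_finsetSum _ fun j _ => hfi i j]
    have : ∀ j, ∫ z, f i j z ∂ν = conj (v i) * H i j * v j + if i = j then H i j else 0 := by
      intro j
      have i2 : Integrable (fun z : Fin k → ℂ => H i j * v j * conj (z i) +
          H i j * (conj (z i) * z j)) ν := ((hconj i).const_mul _).add ((hmul i j).const_mul _)
      have i1 : Integrable (fun z : Fin k → ℂ => conj (v i) * H i j * z j +
          (H i j * v j * conj (z i) + H i j * (conj (z i) * z j))) ν :=
        ((hint j).const_mul _).add i2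
      simp only [hf]
      rw [integral_add (integrable_const _) i1, integral_add ((hint j).const_mul _) i2,
        integral_add ((hconj i).const_mul _) ((hmul i j).const_mul _), integral_const,
        integral_const_mul, integral_const_mul, integral_const_mul, hν.mean, hcm, hν.cov]
      simp
    simp only [this, Finset.sum_add_distrib, Finset.sum_ite_eq, Finset.mem_univ, if_true]
  simp only [h2, Finset.sum_add_distrib]
  rw [Complex.add_re, quad, trace]
  congr 2
  simp only [dotProduct, mulVec, Finset.mul_sum, Pi.star_apply, RCLike.star_def, mul_assoc]

/-- With integrals in [0, ∞], the later recursions need no integrability of the state, so competing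
controls may have infinite cost. -/
theorem lintegral_quad_add (hν : IsWhite ν) {H : Matrix (Fin k) (Fin k) ℂ} (hH : H.PosSemidef)
    (v : Fin k → ℂ) :
    ∫⁻ z, ENNReal.ofReal (quad H (v + z)) ∂ν =
      ENNReal.ofReal (quad H v) + ENNReal.ofReal H.trace.re := by
  obtain ⟨h1, h2⟩ := hν.quad_add H v
  rw [← ofReal_integral_eq_lintegral_ofReal h1 (ae_of_all _ fun z => quad_nonneg hH _), h2,
    ENNReal.ofReal_add (quad_nonneg hH v)]
  exact (Complex.le_def.1 hH.trace_nonneg).1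

end IsWhite

/-- White noise independent of the state adds the trace to a quadratic form. -/
theorem lintegral_quad_add_of_indepFun {Ω : Type*} [MeasurableSpace Ω] {Q : Measure Ω}
    [IsProbabilityMeasure Q] {S Z : Ω → Fin k → ℂ} (hS : Measurable S) (hZ : Measurable Z)
    (h : IndepFun S Z Q) (hν : IsWhite (Q.map Z)) {H : Matrix (Fin k) (Fin k) ℂ}
    (hH : H.PosSemidef) {u : (Fin k → ℂ) → Fin k → ℂ} (hu : Measurable u) :
    ∫⁻ ω, ENNReal.ofReal (quad H (u (S ω) + Z ω)) ∂Q =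
      ∫⁻ ω, ENNReal.ofReal (quad H (u (S ω))) ∂Q + ENNReal.ofReal H.trace.re := by
  have := Measure.isProbabilityMeasure_map (μ := Q) hS.aemeasurable
  have := Measure.isProbabilityMeasure_map (μ := Q) hZ.aemeasurable
  have hmq : Measurable fun s => ENNReal.ofReal (quad H s) :=
    (continuous_quad H).measurable.ennreal_ofReal
  have hm : Measurable fun p : (Fin k → ℂ) × (Fin k → ℂ) =>
      ENNReal.ofReal (quad H (u p.1 + p.2)) :=
    hmq.comp ((hu.comp measurable_fst).add measurable_snd)
  calc _ = ∫⁻ p, ENNReal.ofReal (quad H (u p.1 + p.2)) ∂(Q.map fun ω => (S ω, Z ω)) := by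
        rw [lintegral_map hm (hS.prodMk hZ)]
    _ = ∫⁻ s, ∫⁻ z, ENNReal.ofReal (quad H (u s + z)) ∂(Q.map Z) ∂(Q.map S) := by
        rw [(indepFun_iff_map_prod_eq_prod_map_map hS.aemeasurable hZ.aemeasurable).1 h,
          lintegral_prod _ hm.aemeasurable]
    _ = ∫⁻ s, ENNReal.ofReal (quad H (u s)) + ENNReal.ofReal H.trace.re ∂(Q.map S) := by
        simp only [hν.lintegral_quad_add hH]
    _ = _ := by
        rw [lintegral_add_right _ measurable_const, lintegral_const, measure_univ, mul_one]
        congr 1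
        exact lintegral_map (hmq.comp hu) hS

/-! ### The closed loop -/

/-- The part of the sample before time `t`. -/
noncomputable def past (t : ℕ) (ω : Sample k) : Sample k :=
  (ω.1, fun i => if i < t then ω.2 i else 0)

/-- Causality of the closed loop. It makes the state at time t a function of the past sample, hence
independent of the noise at time t. -/
theorem closedLoop_congr (a : Fin k → ℂ) (π : Control k) {ω ω' : Sample k} (h0 : ω.1 = ω'.1)
    {t : ℕ} (h : ∀ i < t, ω.2 i = ω'.2 i) : closedLoop a π ω t = closedLoop a π ω' t := by
  induction t with
  | zero => exact h0
  | succ t ih =>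
    funext j
    rw [closedLoop, closedLoop, ih fun i hi => h i (hi.trans t.lt_succ_self), h t t.lt_succ_self]

theorem closedLoop_past (a : Fin k → ℂ) (π : Control k) (ω : Sample k) (t : ℕ) :
    closedLoop a π (past t ω) t = closedLoop a π ω t :=
  closedLoop_congr a π (ω := past t ω) (ω' := ω) rfl fun i hi => by simp [past, hi]

theorem measurable_closedLoop (a : Fin k → ℂ) {π : Control k} (hπ : ∀ i, Measurable (π i))
    (t : ℕ) : Measurable fun ω => closedLoop a π ω t := by
  induction t with
  | zero => exact measurable_fst
  | succ t ih =>
    refine measurable_pi_lambda _ fun j => ?_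
    simp only [closedLoop]
    have h1 : Measurable fun ω : Sample k => ω.2 t j :=
      (measurable_pi_apply j).comp ((measurable_pi_apply t).comp measurable_snd)
    exact (((measurable_pi_apply j).comp ih).const_mul _).add (((hπ t).comp ih).add h1)

theorem closedLoop_succ (a : Fin k → ℂ) (π : Control k) (ω : Sample k) (t : ℕ) :
    closedLoop a π ω (t + 1) = (diagonal a *ᵥ closedLoop a π ω t +
      π t (closedLoop a π ω t) • 1) + ω.2 t := by
  funext j
  rw [closedLoop, Pi.add_apply, Pi.add_apply, mulVec_diagonal, Pi.smul_apply, Pi.one_apply,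
    smul_eq_mul, mul_one, add_assoc]

/-- Under `Q` the noise at time `t` is white and independent of the past. -/
structure WhiteAt (Q : Measure (Sample k)) (t : ℕ) : Prop where
  indep : IndepFun (past t) (fun ω => ω.2 t) Q
  white : IsWhite (Q.map fun ω => ω.2 t)

theorem measurable_noise (t : ℕ) : Measurable fun ω : Sample k => ω.2 t :=
  (measurable_pi_apply t).comp measurable_snd

/-! ### Recursions for the cost and the second moment of the state -/

section Dynamics

variable {Q : Measure (Sample k)} [IsProbabilityMeasure Q] {a : Fin k → ℂ}

/-- The common source of all recursions: H = G gives the power balance, H = G'G the boundedness of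
the state, and a diagonal matrix unit the lower bound on one coordinate. -/
theorem WhiteAt.lintegral_quad_succ {t : ℕ} (hQ : WhiteAt Q t) {π : Control k}
    (hπ : ∀ i, Measurable (π i)) {H : Matrix (Fin k) (Fin k) ℂ} (hH : H.PosSemidef) :
    ∫⁻ ω, ENNReal.ofReal (quad H (closedLoop a π ω (t + 1))) ∂Q =
      ∫⁻ ω, ENNReal.ofReal (quad H (diagonal a *ᵥ closedLoop a π ω t +
        π t (closedLoop a π ω t) • 1)) ∂Q + ENNReal.ofReal H.trace.re := by
  have hI : IndepFun (fun ω => closedLoop a π ω t) (fun ω => ω.2 t) Q := by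
    have h1 := hQ.indep.comp (measurable_closedLoop a hπ t) measurable_id
    have h2 : (fun ω => closedLoop a π ω t) ∘ past t = fun ω : Sample k => closedLoop a π ω t :=
      funext fun ω => closedLoop_past a π ω t
    rwa [h2] at h1
  have hu : Measurable fun s : Fin k → ℂ => diagonal a *ᵥ s + π t s • (1 : Fin k → ℂ) := by
    refine measurable_pi_lambda _ fun j => ?_
    simp only [Pi.add_apply, mulVec_diagonal, Pi.smul_apply, Pi.one_apply, smul_eq_mul, mul_one]
    exact ((measurable_pi_apply j).const_mul _).add (hπ t)
  simp only [closedLoop_succ]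
  exact lintegral_quad_add_of_indepFun (S := fun ω => closedLoop a π ω t) (Z := fun ω => ω.2 t)
    (u := fun s => diagonal a *ᵥ s + π t s • 1) (measurable_closedLoop a hπ t)
    (measurable_noise t) hI hQ.white hH hu

/-- The expected power of the symbol at time `t`. -/
noncomputable def symbolPower (Q : Measure (Sample k)) (a : Fin k → ℂ) (π : Control k) (t : ℕ) :
    ℝ≥0∞ :=
  ∫⁻ ω, ENNReal.ofReal (‖π t (closedLoop a π ω t)‖ ^ 2) ∂Q

/-- The expected value of a quadratic form of the state at time `t`. -/
noncomputable def stateCost (Q : Measure (Sample k)) (a : Fin k → ℂ) (π : Control k)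
    (H : Matrix (Fin k) (Fin k) ℂ) (t : ℕ) : ℝ≥0∞ :=
  ∫⁻ ω, ENNReal.ofReal (quad H (closedLoop a π ω t)) ∂Q

theorem measurable_quad_closedLoop {π : Control k} (hπ : ∀ i, Measurable (π i))
    (H : Matrix (Fin k) (Fin k) ℂ) (t : ℕ) :
    Measurable fun ω => ENNReal.ofReal (quad H (closedLoop a π ω t)) :=
  ((continuous_quad H).measurable.comp (measurable_closedLoop a hπ t)).ennreal_ofReal

theorem measurable_symbol {π : Control k} (hπ : ∀ i, Measurable (π i)) (t : ℕ) :
    Measurable fun ω => ENNReal.ofReal (‖π t (closedLoop a π ω t)‖ ^ 2) :=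
  ((((hπ t).comp (measurable_closedLoop a hπ t)).norm).pow_const 2).ennreal_ofReal

variable {G : Matrix (Fin k) (Fin k) ℂ}

theorem lqgControl_apply (i : ℕ) (s : Fin k → ℂ) : lqgControl a G i s = -gainDot a G s := rfl

theorem measurable_lqgControl (i : ℕ) : Measurable (lqgControl a G i) := by
  unfold lqgControl
  exact (Finset.measurable_sum _ fun j _ => (measurable_pi_apply j).const_mul _).neg

theorem WhiteAt.stateCost_add_symbolPower {t : ℕ} (hQ : WhiteAt Q t)
    (hG : IsStabilizingDARESolution a G) {π : Control k} (hπ : ∀ i, Measurable (π i)) :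
    stateCost Q a π G (t + 1) + symbolPower Q a π t =
      ∫⁻ ω, ENNReal.ofReal (quad G (closedLoop a π ω t) + (innovationGain G).re *
        ‖π t (closedLoop a π ω t) + gainDot a G (closedLoop a π ω t)‖ ^ 2) ∂Q +
        ENNReal.ofReal G.trace.re := by
  rw [stateCost, hQ.lintegral_quad_succ hπ hG.1.posSemidef, symbolPower, add_right_comm,
    ← lintegral_add_right _ (measurable_symbol hπ t)]
  congr 1
  refine lintegral_congr fun ω => ?_
  rw [← ENNReal.ofReal_add (quad_nonneg hG.1.posSemidef _) (by positivity), hG.quad_add_sq]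

/-- Dropping the completed square, which is nonnegative and vanishes exactly for the symbol −Cs. -/
theorem WhiteAt.stateCost_add_trace_le {t : ℕ} (hQ : WhiteAt Q t)
    (hG : IsStabilizingDARESolution a G) {π : Control k} (hπ : ∀ i, Measurable (π i)) :
    stateCost Q a π G t + ENNReal.ofReal G.trace.re ≤
      stateCost Q a π G (t + 1) + symbolPower Q a π t := by
  rw [hQ.stateCost_add_symbolPower hG hπ]
  gcongr
  refine lintegral_mono fun ω => ENNReal.ofReal_le_ofReal ?_
  obtain ⟨β, hβ, hGβ⟩ := innovationGain_re hG.1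
  rw [hGβ, Complex.ofReal_re]
  have : 0 ≤ β * ‖π t (closedLoop a π ω t) + gainDot a G (closedLoop a π ω t)‖ ^ 2 := by positivity
  linarith

theorem WhiteAt.stateCost_lqgControl {t : ℕ} (hQ : WhiteAt Q t)
    (hG : IsStabilizingDARESolution a G) :
    stateCost Q a (lqgControl a G) G (t + 1) + symbolPower Q a (lqgControl a G) t =
      stateCost Q a (lqgControl a G) G t + ENNReal.ofReal G.trace.re := by
  rw [hQ.stateCost_add_symbolPower hG measurable_lqgControl]
  simp [lqgControl_apply, stateCost]

/-- Telescoping, in additive form because costs may be infinite. Whiteness is required only before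
time n, since a real block supplies finitely many noise pairs. -/
theorem stateCost_add_trace_le_sum (hG : IsStabilizingDARESolution a G) {π : Control k}
    (hπ : ∀ i, Measurable (π i)) {n : ℕ} (hQ : ∀ t < n, WhiteAt Q t) :
    stateCost Q a π G 0 + n * ENNReal.ofReal G.trace.re ≤
      stateCost Q a π G n + ∑ t ∈ Finset.range n, symbolPower Q a π t := by
  induction n with
  | zero => simp
  | succ n ih =>
    have h1 := ih fun t ht => hQ t (ht.trans n.lt_succ_self)
    have h2 := (hQ n n.lt_succ_self).stateCost_add_trace_le hG hπ
    rw [Finset.sum_range_succ]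
    push_cast
    calc _ = (stateCost Q a π G 0 + n * ENNReal.ofReal G.trace.re) + ENNReal.ofReal G.trace.re := by
          ring
      _ ≤ (stateCost Q a π G n + ENNReal.ofReal G.trace.re) +
          ∑ t ∈ Finset.range n, symbolPower Q a π t := by
          rw [add_right_comm (stateCost Q a π G n)]; gcongr
      _ ≤ (stateCost Q a π G (n + 1) + symbolPower Q a π n) +
          ∑ t ∈ Finset.range n, symbolPower Q a π t := by gcongr
      _ = _ := by ring

theorem stateCost_add_sum_lqgControl (hG : IsStabilizingDARESolution a G) {n : ℕ}
    (hQ : ∀ t < n, WhiteAt Q t) :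
    stateCost Q a (lqgControl a G) G n +
        ∑ t ∈ Finset.range n, symbolPower Q a (lqgControl a G) t =
      stateCost Q a (lqgControl a G) G 0 + n * ENNReal.ofReal G.trace.re := by
  induction n with
  | zero => simp
  | succ n ih =>
    have h1 := ih fun t ht => hQ t (ht.trans n.lt_succ_self)
    have h2 := (hQ n n.lt_succ_self).stateCost_lqgControl hG
    rw [Finset.sum_range_succ]
    push_cast
    calc _ = (stateCost Q a (lqgControl a G) G (n + 1) + symbolPower Q a (lqgControl a G) n) +
          ∑ t ∈ Finset.range n, symbolPower Q a (lqgControl a G) t := by ring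
      _ = (stateCost Q a (lqgControl a G) G n +
          ∑ t ∈ Finset.range n, symbolPower Q a (lqgControl a G) t) +
            ENNReal.ofReal G.trace.re := by rw [h2]; ring
      _ = _ := by rw [h1]; ring

variable {α : ℝ}

/-- The contraction of Gs plus fresh noise gives an affine recursion with ratio α⁻² < 1, so no
abstract stability theory is needed. -/
theorem WhiteAt.stateCost_sq_succ {t : ℕ} (hQ : WhiteAt Q t)
    (hG : IsStabilizingDARESolution a G) (hα : 0 < α) (ha : ∀ j, ‖a j‖ = α) :
    stateCost Q a (lqgControl a G) (Gᴴ * G) (t + 1) =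
      ENNReal.ofReal ((α ^ 2)⁻¹) * stateCost Q a (lqgControl a G) (Gᴴ * G) t +
        ENNReal.ofReal (Gᴴ * G).trace.re := by
  rw [stateCost, hQ.lintegral_quad_succ measurable_lqgControl
    (posSemidef_conjTranspose_mul_self G)]
  congr 1
  simp only [lqgControl_apply, neg_smul, ← sub_eq_add_neg, hG.quad_closedLoop hα ha]
  rw [stateCost, ← lintegral_const_mul _ (measurable_quad_closedLoop measurable_lqgControl _ _)]
  refine lintegral_congr fun ω => ?_
  rw [ENNReal.ofReal_mul (by positivity)]

/-- The quadratic form `‖G s‖²` of the state stays bounded under the LQG control. -/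
theorem stateCost_sq_le (hG : IsStabilizingDARESolution a G) (hα : 1 < α) (ha : ∀ j, ‖a j‖ = α)
    {n : ℕ} (hQ : ∀ t < n, WhiteAt Q t) :
    stateCost Q a (lqgControl a G) (Gᴴ * G) n ≤
      stateCost Q a (lqgControl a G) (Gᴴ * G) 0 +
        ENNReal.ofReal ((Gᴴ * G).trace.re / (1 - (α ^ 2)⁻¹)) := by
  have hρ : (α ^ 2)⁻¹ < 1 := inv_lt_one_of_one_lt₀ (one_lt_pow₀ hα two_ne_zero)
  have hρ0 : 0 ≤ (α ^ 2)⁻¹ := by positivity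
  have htr : 0 ≤ (Gᴴ * G).trace.re :=
    (Complex.le_def.1 (posSemidef_conjTranspose_mul_self G).trace_nonneg).1
  set U := stateCost Q a (lqgControl a G) (Gᴴ * G)
  set h := (Gᴴ * G).trace.re
  set ρ := (α ^ 2)⁻¹
  have h1ρ : 0 < 1 - ρ := by linarith
  induction n with
  | zero => exact le_self_add
  | succ n ih =>
    have h1 := ih fun t ht => hQ t (ht.trans n.lt_succ_self)
    have hstep : U (n + 1) = ENNReal.ofReal ρ * U n + ENNReal.ofReal h :=
      (hQ n n.lt_succ_self).stateCost_sq_succ hG (by linarith) ha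
    rw [hstep]
    calc _ ≤ ENNReal.ofReal ρ * (U 0 + ENNReal.ofReal (h / (1 - ρ))) + ENNReal.ofReal h := by
          gcongr
      _ = ENNReal.ofReal ρ * U 0 + (ENNReal.ofReal (ρ * (h / (1 - ρ))) + ENNReal.ofReal h) := by
          rw [mul_add, ENNReal.ofReal_mul hρ0, add_assoc]
      -- The number h/(1 − ρ) is the fixed point of u ↦ ρu + h.
      _ ≤ 1 * U 0 + ENNReal.ofReal (h / (1 - ρ)) := by
          gcongr
          · exact ENNReal.ofReal_le_one.2 hρ.le
          · rw [← ENNReal.ofReal_add (by positivity) htr]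
            refine ENNReal.ofReal_le_ofReal (le_of_eq ?_)
            field_simp
            ring
      _ = _ := by rw [one_mul]

/-- The second moment of the state under the LQG control is bounded in terms of the initial
state. -/
theorem exists_secondMoment_le (hG : IsStabilizingDARESolution a G) (hα : 1 < α)
    (ha : ∀ j, ‖a j‖ = α) :
    ∃ c : ℝ, 0 ≤ c ∧ ∀ (Q : Measure (Sample k)) [IsProbabilityMeasure Q] (n : ℕ),
      (∀ t < n, WhiteAt Q t) →
      ∫⁻ ω, ENNReal.ofReal (∑ j, ‖closedLoop a (lqgControl a G) ω n j‖ ^ 2) ∂Q ≤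
        ENNReal.ofReal c * (∫⁻ ω, ENNReal.ofReal (∑ j, ‖ω.1 j‖ ^ 2) ∂Q + 1) := by
  obtain ⟨c₁, hc₁, h₁⟩ := exists_sum_sq_le_quad hG.1.isUnit
  obtain ⟨c₂, hc₂, h₂⟩ := exists_quad_le (Gᴴ * G)
  set K := (Gᴴ * G).trace.re / (1 - (α ^ 2)⁻¹) with hK
  -- The constant is chosen before the law and the time, so one bound serves all message vectors and
  -- block lengths.
  refine ⟨c₁ * max c₂ K, by positivity, fun Q _ n hQ => ?_⟩
  calc _ ≤ ∫⁻ ω, ENNReal.ofReal c₁ *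
        ENNReal.ofReal (quad (Gᴴ * G) (closedLoop a (lqgControl a G) ω n)) ∂Q := by
        refine lintegral_mono fun ω => ?_
        rw [← ENNReal.ofReal_mul hc₁]
        exact ENNReal.ofReal_le_ofReal (h₁ _)
    _ = ENNReal.ofReal c₁ * stateCost Q a (lqgControl a G) (Gᴴ * G) n :=
        lintegral_const_mul _ (measurable_quad_closedLoop measurable_lqgControl _ _)
    _ ≤ ENNReal.ofReal c₁ * (stateCost Q a (lqgControl a G) (Gᴴ * G) 0 + ENNReal.ofReal K) := by
        gcongr
        exact stateCost_sq_le hG hα ha hQ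
    _ ≤ ENNReal.ofReal c₁ * (ENNReal.ofReal (max c₂ K) *
          ∫⁻ ω, ENNReal.ofReal (∑ j, ‖ω.1 j‖ ^ 2) ∂Q + ENNReal.ofReal (max c₂ K)) := by
        gcongr
        · rw [stateCost, ← lintegral_const_mul' _ _ ENNReal.ofReal_ne_top]
          refine lintegral_mono fun ω => ?_
          rw [← ENNReal.ofReal_mul (by positivity)]
          refine ENNReal.ofReal_le_ofReal ((h₂ _).trans ?_)
          exact mul_le_mul_of_nonneg_right (le_max_left _ _) (by positivity)
        · exact le_max_right _ _
    _ = _ := by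
        rw [ENNReal.ofReal_mul hc₁]
        ring

end Dynamics

end GaussianBC

namespace GaussianBC

open Matrix

variable {k : ℕ}

/-! ### The noise laws are white -/

/-- Serves both the circular Gaussian noise and the complex noise assembled from pairs of real
noises. -/
theorem isWhite_of_re_im {Ω : Type*} [MeasurableSpace Ω] {Q : Measure Ω} [IsProbabilityMeasure Q]
    {X Y : Ω → Fin k → ℝ} (hX : ∀ j, Measurable fun ω => X ω j) (hY : ∀ j, Measurable fun ω => Y ω j)
    (hX2 : ∀ j, MemLp (fun ω => X ω j) 2 Q) (hY2 : ∀ j, MemLp (fun ω => Y ω j) 2 Q)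
    (hXm : ∀ j, ∫ ω, X ω j ∂Q = 0) (hYm : ∀ j, ∫ ω, Y ω j ∂Q = 0)
    (hXX : ∀ i j, ∫ ω, X ω i * X ω j ∂Q = if i = j then 1 / 2 else 0)
    (hYY : ∀ i j, ∫ ω, Y ω i * Y ω j ∂Q = if i = j then 1 / 2 else 0)
    (hXY : ∀ i j, ∫ ω, X ω i * Y ω j ∂Q = 0) :
    IsWhite (Q.map fun ω j => (⟨X ω j, Y ω j⟩ : ℂ)) := by
  have hm : Measurable fun ω j => (⟨X ω j, Y ω j⟩ : ℂ) :=
    measurable_pi_lambda _ fun j => measurable_complexMk.comp ((hX j).prodMk (hY j))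
  have hXi : ∀ j, Integrable (fun ω => X ω j) Q := fun j => (hX2 j).integrable one_le_two
  have hYi : ∀ j, Integrable (fun ω => Y ω j) Q := fun j => (hY2 j).integrable one_le_two
  have hmk : ∀ x y : ℝ, (⟨x, y⟩ : ℂ) = (x : ℂ) + (y : ℂ) * Complex.I := fun x y =>
    Complex.mk_eq_add_mul_I x y
  refine ⟨fun j => ?_, fun j => ?_, fun i j => ?_⟩
  · rw [memLp_map_measure_iff (measurable_pi_apply j).aestronglyMeasurable hm.aemeasurable]
    have := (hX2 j).ofReal (K := ℂ) |>.add ((hY2 j).ofReal (K := ℂ) |>.mul_const Complex.I)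
    refine this.congr_norm ((measurable_pi_apply j).comp hm).aestronglyMeasurable
      (ae_of_all _ fun ω => ?_)
    simp only [Function.comp, Pi.add_apply, hmk]
    rfl
  · rw [integral_map hm.aemeasurable (measurable_pi_apply j).aestronglyMeasurable]
    simp only [hmk]
    rw [integral_add (hXi j).ofReal ((hYi j).ofReal.mul_const _), integral_mul_const,
      integral_complex_ofReal, integral_complex_ofReal, hXm, hYm]
    simp
  · have hmeas : Measurable fun z : Fin k → ℂ => conj (z i) * z j :=
      (Complex.continuous_conj.measurable.comp (measurable_pi_apply i)).mul (measurable_pi_apply j)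
    rw [integral_map hm.aemeasurable hmeas.aestronglyMeasurable]
    have hXXi : Integrable (fun ω => X ω i * X ω j) Q := (hX2 i).integrable_mul (hX2 j)
    have hYYi : Integrable (fun ω => Y ω i * Y ω j) Q := (hY2 i).integrable_mul (hY2 j)
    have hXYi : Integrable (fun ω => X ω i * Y ω j) Q := (hX2 i).integrable_mul (hY2 j)
    have hYXi : Integrable (fun ω => X ω j * Y ω i) Q := (hX2 j).integrable_mul (hY2 i)
    have e : ∀ ω, conj (⟨X ω i, Y ω i⟩ : ℂ) * (⟨X ω j, Y ω j⟩ : ℂ) =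
        ((X ω i * X ω j + Y ω i * Y ω j : ℝ) : ℂ) +
          ((X ω i * Y ω j - X ω j * Y ω i : ℝ) : ℂ) * Complex.I := by
      intro ω
      apply Complex.ext <;> simp
      ring
    simp only [e]
    rw [integral_add (hXXi.add hYYi).ofReal ((hXYi.sub hYXi).ofReal.mul_const _),
      integral_mul_const, integral_complex_ofReal, integral_complex_ofReal,
      integral_add hXXi hYYi, integral_sub hXYi hYXi, hXX, hYY, hXY, hXY]
    split_ifs <;> norm_num

theorem integral_pi_mul {ι E : Type*} [Fintype ι] [DecidableEq ι] [MeasurableSpace E]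
    (ν : Measure E) [IsProbabilityMeasure ν] {f g : E → ℝ} (hf : Measurable f) (hg : Measurable g)
    (i j : ι) :
    ∫ z, f (z i) * g (z j) ∂(Measure.pi fun _ : ι => ν) =
      if i = j then ∫ x, f x * g x ∂ν else (∫ x, f x ∂ν) * ∫ x, g x ∂ν := by
  have hev : ∀ (i : ι) {f : E → ℝ}, Measurable f →
      ∫ z, f (z i) ∂(Measure.pi fun _ : ι => ν) = ∫ x, f x ∂ν := fun i f hf =>
    integral_comp_eval (μ := fun _ : ι => ν) hf.aestronglyMeasurable
  split_ifs with h
  · subst h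
    exact hev i (hf.mul hg)
  · have hI : iIndepFun (fun i (ω : ι → E) => ω i) (Measure.pi fun _ : ι => ν) :=
      iIndepFun_pi (X := fun _ : ι => (id : E → E)) fun _ => aemeasurable_id
    have := (hI.indepFun h).comp hf hg
    rw [← hev i hf, ← hev j hg]
    exact this.integral_fun_mul_eq_mul_integral
      (hf.comp (measurable_pi_apply i)).aestronglyMeasurable
      (hg.comp (measurable_pi_apply j)).aestronglyMeasurable

theorem integral_sq_gaussianReal (v : NNReal) : ∫ x, x * x ∂(gaussianReal 0 v) = v := by
  have h := variance_of_integral_eq_zero (X := id) (μ := gaussianReal 0 v) aemeasurable_id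
    integral_id_gaussianReal
  rw [variance_id_gaussianReal] at h
  rw [h]
  exact integral_congr_ae (ae_of_all _ fun x => (sq x).symm)

theorem memLp_two_gaussianReal (v : NNReal) : MemLp (fun x : ℝ => x) 2 (gaussianReal 0 v) :=
  memLp_id_gaussianReal 2

theorem isWhite_pi_complexGaussian : IsWhite (Measure.pi fun _ : Fin k => complexGaussian) := by
  set γ := gaussianReal 0 (1 / 2) with hγ
  have hmap : ∀ {f : ℂ → ℝ}, Measurable f →
      ∫ z, f z ∂complexGaussian = ∫ p : ℝ × ℝ, f ⟨p.1, p.2⟩ ∂(γ.prod γ) := fun hf =>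
    integral_map measurable_complexMk.aemeasurable hf.aestronglyMeasurable
  have hre : Measurable Complex.re := Complex.measurable_re
  have him : Measurable Complex.im := Complex.measurable_im
  have h0 : ∫ x, x ∂γ = 0 := integral_id_gaussianReal
  have m1 : ∫ z, z.re ∂complexGaussian = 0 := by
    rw [hmap hre, integral_fun_fst fun x : ℝ => x, h0, smul_zero]
  have m2 : ∫ z, z.im ∂complexGaussian = 0 := by
    rw [hmap him, integral_fun_snd fun x : ℝ => x, h0, smul_zero]
  have c1 : ∫ z, z.re * z.re ∂complexGaussian = 1 / 2 := by
    rw [hmap (f := fun z => z.re * z.re) (hre.mul hre), integral_fun_fst fun x : ℝ => x * x, hγ, integral_sq_gaussianReal]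
    simp
  have c2 : ∫ z, z.im * z.im ∂complexGaussian = 1 / 2 := by
    rw [hmap (f := fun z => z.im * z.im) (him.mul him), integral_fun_snd fun x : ℝ => x * x, hγ, integral_sq_gaussianReal]
    simp
  have c3 : ∫ z, z.re * z.im ∂complexGaussian = 0 := by
    rw [hmap (f := fun z => z.re * z.im) (hre.mul him), integral_prod_mul (fun x : ℝ => x) (fun x : ℝ => x), h0, zero_mul]
  have l1 : MemLp (fun z : ℂ => z.re) 2 complexGaussian := by
    rw [complexGaussian, memLp_map_measure_iff hre.aestronglyMeasurable
      measurable_complexMk.aemeasurable]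
    exact (memLp_two_gaussianReal (1 / 2)).comp_measurePreserving
      (measurePreserving_fst (μ := γ) (ν := γ))
  have l2 : MemLp (fun z : ℂ => z.im) 2 complexGaussian := by
    rw [complexGaussian, memLp_map_measure_iff him.aestronglyMeasurable
      measurable_complexMk.aemeasurable]
    exact (memLp_two_gaussianReal (1 / 2)).comp_measurePreserving
      (measurePreserving_snd (μ := γ) (ν := γ))
  have hev := measurePreserving_eval fun _ : Fin k => complexGaussian
  have := isWhite_of_re_im (Q := Measure.pi fun _ : Fin k => complexGaussian)
    (X := fun z j => (z j).re) (Y := fun z j => (z j).im)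
    (fun j => hre.comp (measurable_pi_apply j)) (fun j => him.comp (measurable_pi_apply j))
    (fun j => l1.comp_measurePreserving (hev j)) (fun j => l2.comp_measurePreserving (hev j))
    (fun j => (integral_comp_eval (μ := fun _ : Fin k => complexGaussian)
      hre.aestronglyMeasurable).trans m1)
    (fun j => (integral_comp_eval (μ := fun _ : Fin k => complexGaussian)
      him.aestronglyMeasurable).trans m2)
    (fun i j => by rw [integral_pi_mul complexGaussian hre hre, c1, m1, mul_zero])
    (fun i j => by rw [integral_pi_mul complexGaussian him him, c2, m2, mul_zero])
    (fun i j => by rw [integral_pi_mul complexGaussian hre him, c3, m1, zero_mul, ite_self])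
  simpa using this

/-! ### The sample law -/

theorem volume_unitSquare : volume (Set.Ioo (0 : ℝ) 1 ×ℂ Set.Ioo (0 : ℝ) 1) = 1 := by
  have h : (Set.Ioo (0 : ℝ) 1 ×ℂ Set.Ioo (0 : ℝ) 1) =
      Complex.measurableEquivRealProd ⁻¹' (Set.Ioo (0 : ℝ) 1 ×ˢ Set.Ioo (0 : ℝ) 1) := rfl
  rw [h, Complex.volume_preserving_equiv_real_prod.measure_preimage_equiv, Measure.volume_eq_prod,
    Measure.prod_prod]
  simp

instance : IsProbabilityMeasure unifSquare :=
  ⟨by rw [unifSquare, Measure.restrict_apply_univ, volume_unitSquare]⟩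

instance : IsProbabilityMeasure (sampleLaw k) := by
  unfold sampleLaw
  infer_instance

theorem norm_sq_le_of_mem_unitSquare {θ : ℂ} (h : θ ∈ Set.Ioo (0 : ℝ) 1 ×ℂ Set.Ioo (0 : ℝ) 1) :
    ‖θ‖ ^ 2 ≤ 2 := by
  obtain ⟨⟨h1, h2⟩, h3, h4⟩ := h
  rw [← Complex.normSq_eq_norm_sq, Complex.normSq_apply]
  nlinarith

theorem lintegral_norm_sq_initial_le :
    ∫⁻ ω, ENNReal.ofReal (∑ j, ‖ω.1 j‖ ^ 2) ∂(sampleLaw k) ≤ k * 2 := by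
  have hm : ∀ j : Fin k, Measurable fun ω : Sample k => ENNReal.ofReal (‖ω.1 j‖ ^ 2) := fun j =>
    (((measurable_pi_apply j).comp measurable_fst).norm.pow_const 2).ennreal_ofReal
  have hm1 : Measurable fun θ : ℂ => ENNReal.ofReal (‖θ‖ ^ 2) :=
    (measurable_id.norm.pow_const 2).ennreal_ofReal
  have h1 : ∫⁻ θ, ENNReal.ofReal (‖θ‖ ^ 2) ∂unifSquare ≤ 2 := by
    have hms : MeasurableSet (Set.Ioo (0 : ℝ) 1 ×ℂ Set.Ioo (0 : ℝ) 1) :=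
      (Complex.measurable_re measurableSet_Ioo).inter (Complex.measurable_im measurableSet_Ioo)
    calc _ ≤ ∫⁻ θ in Set.Ioo (0 : ℝ) 1 ×ℂ Set.Ioo (0 : ℝ) 1, 2 := by
          refine setLIntegral_mono' hms fun θ hθ => ?_
          rw [← ENNReal.ofReal_ofNat 2]
          exact ENNReal.ofReal_le_ofReal (norm_sq_le_of_mem_unitSquare hθ)
      _ = 2 := by rw [lintegral_const, Measure.restrict_apply_univ, volume_unitSquare, mul_one]
  have h2 : ∫⁻ ω, ENNReal.ofReal (∑ j, ‖ω.1 j‖ ^ 2) ∂(sampleLaw k) =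
      ∑ j : Fin k, ∫⁻ ω, ENNReal.ofReal (‖ω.1 j‖ ^ 2) ∂(sampleLaw k) := by
    rw [← lintegral_finsetSum _ fun j _ => hm j]
    refine lintegral_congr fun ω => ?_
    rw [ENNReal.ofReal_sum_of_nonneg fun j _ => by positivity]
  have h3 : ∀ j : Fin k, ∫⁻ ω, ENNReal.ofReal (‖ω.1 j‖ ^ 2) ∂(sampleLaw k) =
      ∫⁻ θ, ENNReal.ofReal (‖θ‖ ^ 2) ∂unifSquare := by
    intro j
    have e1 := (measurePreserving_fst (μ := Measure.pi fun _ : Fin k => unifSquare)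
      (ν := Measure.infinitePi fun _ : ℕ => Measure.pi fun _ : Fin k => complexGaussian))
    have e2 := measurePreserving_eval (fun _ : Fin k => unifSquare) j
    exact (e2.comp e1).lintegral_comp hm1
  rw [h2]
  simp only [h3, Finset.sum_const, Finset.card_univ, Fintype.card_fin, nsmul_eq_mul]
  gcongr

/-- Adjoins the independent initial state to the past noise; the joint law factors by associativity
of the product measure. -/
theorem indepFun_prod_of_indepFun_snd {α β γ δ : Type*} [MeasurableSpace α] [MeasurableSpace β]
    [MeasurableSpace γ] [MeasurableSpace δ] (μ : Measure α) (ν : Measure β)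
    [IsProbabilityMeasure μ] [IsProbabilityMeasure ν] {R : β → γ} {Z : β → δ} (hR : Measurable R)
    (hZ : Measurable Z) (h : IndepFun R Z ν) :
    IndepFun (fun p : α × β => (p.1, R p.2)) (fun p => Z p.2) (μ.prod ν) := by
  have := Measure.isProbabilityMeasure_map (μ := ν) hR.aemeasurable
  have := Measure.isProbabilityMeasure_map (μ := ν) hZ.aemeasurable
  have hR' : Measurable fun p : α × β => (p.1, R p.2) :=
    measurable_fst.prodMk (hR.comp measurable_snd)
  have hZ' : Measurable fun p : α × β => Z p.2 := hZ.comp measurable_snd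
  rw [indepFun_iff_map_prod_eq_prod_map_map hR'.aemeasurable hZ'.aemeasurable]
  have e1 : (μ.prod ν).map (fun p : α × β => (p.1, R p.2)) = μ.prod (ν.map R) := by
    have := Measure.map_prod_map μ ν measurable_id hR
    rw [Measure.map_id] at this
    exact this.symm
  have e2 : (μ.prod ν).map (fun p : α × β => Z p.2) = ν.map Z := by
    have : (fun p : α × β => Z p.2) = Z ∘ Prod.snd := rfl
    rw [this, ← Measure.map_map hZ measurable_snd, (measurePreserving_snd (μ := μ) (ν := ν)).map_eq]
  have e3 : μ.prod (ν.map fun b => (R b, Z b)) =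
      (μ.prod ν).map (fun p : α × β => (p.1, (R p.2, Z p.2))) := by
    have := Measure.map_prod_map μ ν measurable_id (hR.prodMk hZ)
    rw [Measure.map_id] at this
    exact this
  rw [e1, e2]
  rw [(indepFun_iff_map_prod_eq_prod_map_map hR.aemeasurable hZ.aemeasurable).1 h,
    ← Measure.prodAssoc_prod] at e3
  have hRZ : Measurable fun p : α × β => (p.1, (R p.2, Z p.2)) :=
    measurable_fst.prodMk ((hR.comp measurable_snd).prodMk hZ')
  have e4 := congrArg (Measure.map MeasurableEquiv.prodAssoc.symm) e3
  rw [Measure.map_map MeasurableEquiv.prodAssoc.symm.measurable MeasurableEquiv.prodAssoc.measurable,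
    MeasurableEquiv.symm_comp_self, Measure.map_id,
    Measure.map_map MeasurableEquiv.prodAssoc.symm.measurable hRZ] at e4
  rw [e4]
  rfl

theorem whiteAt_sampleLaw (t : ℕ) : WhiteAt (sampleLaw k) t := by
  set μ := Measure.pi fun _ : Fin k => unifSquare
  set ν := Measure.infinitePi fun _ : ℕ => Measure.pi fun _ : Fin k => complexGaussian with hν
  constructor
  · refine indepFun_prod_of_indepFun_snd μ ν (R := fun z i => if i < t then z i else 0)
      (Z := fun z => z t) ?_ (measurable_pi_apply t) ?_
    · refine measurable_pi_lambda _ fun i => ?_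
      split_ifs
      · exact measurable_pi_apply i
      · exact measurable_const
    · have hI : iIndepFun (fun (i : ℕ) (z : ℕ → Fin k → ℂ) => z i) ν :=
        iIndepFun_infinitePi (X := fun _ : ℕ => (id : (Fin k → ℂ) → Fin k → ℂ))
          fun _ => measurable_id
      have h := hI.indepFun_finset (Finset.range t) {t} (by simp) fun i => measurable_pi_apply i
      have hφ : Measurable fun (r : (Finset.range t) → Fin k → ℂ) (i : ℕ) =>
          if hi : i < t then r ⟨i, Finset.mem_range.2 hi⟩ else 0 := by
        refine measurable_pi_lambda _ fun i => ?_
        split_ifs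
        · exact measurable_pi_apply _
        · exact measurable_const
      have hψ : Measurable fun r : ({t} : Finset ℕ) → Fin k → ℂ =>
          r ⟨t, Finset.mem_singleton_self t⟩ := measurable_pi_apply _
      exact h.comp hφ hψ
  · have : (sampleLaw k).map (fun ω => ω.2 t) = Measure.pi fun _ : Fin k => complexGaussian := by
      have e1 := measurePreserving_snd (μ := μ) (ν := ν)
      have e2 := measurePreserving_eval_infinitePi
        (fun _ : ℕ => Measure.pi fun _ : Fin k => complexGaussian) t
      exact (e2.comp e1).map_eq
    rw [this]
    exact isWhite_pi_complexGaussian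

end GaussianBC

namespace GaussianBC

open Matrix

variable {k : ℕ} {a : Fin k → ℂ} {G : Matrix (Fin k) (Fin k) ℂ} {α : ℝ}

/-! ### The LQG control of the complex system -/

theorem controlPower_eq (π : Control k) (n : ℕ) :
    controlPower a π n = (∑ t ∈ Finset.range n, symbolPower (sampleLaw k) a π t) / n := rfl

theorem tendsto_const_div_natCast {c : ℝ≥0∞} (hc : c ≠ ⊤) :
    Tendsto (fun n : ℕ => c / n) atTop (𝓝 0) := by
  have := ENNReal.Tendsto.const_div (a := c) ENNReal.tendsto_nat_nhds_top (Or.inr hc)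
  simpa using this

/-- Uniform bound on the second moment of the state under the LQG control. -/
theorem exists_secondMoment_le_sampleLaw (hG : IsStabilizingDARESolution a G) (hα : 1 < α)
    (ha : ∀ j, ‖a j‖ = α) :
    ∃ K : ℝ≥0∞, K ≠ ⊤ ∧ ∀ n, ∫⁻ ω, ENNReal.ofReal
      (∑ j, ‖closedLoop a (lqgControl a G) ω n j‖ ^ 2) ∂(sampleLaw k) ≤ K := by
  obtain ⟨c, hc, h⟩ := exists_secondMoment_le hG hα ha
  refine ⟨ENNReal.ofReal c * (k * 2 + 1), ?_, fun n => ?_⟩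
  · exact ENNReal.mul_ne_top ENNReal.ofReal_ne_top (by simp [ENNReal.mul_eq_top])
  · refine (h (sampleLaw k) n fun t _ => whiteAt_sampleLaw t).trans ?_
    gcongr
    exact lintegral_norm_sq_initial_le

theorem stabilizes_lqgControl (hG : IsStabilizingDARESolution a G) (hα : 1 < α)
    (ha : ∀ j, ‖a j‖ = α) : Stabilizes a (lqgControl a G) := by
  obtain ⟨K, hK, h⟩ := exists_secondMoment_le_sampleLaw hG hα ha
  exact (limsup_le_of_le (by isBoundedDefault) (Eventually.of_forall h)).trans_lt hK.lt_top

theorem stateCost_le {Q : Measure (Sample k)} {π : Control k} {c : ℝ} (hc : 0 ≤ c)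
    {H : Matrix (Fin k) (Fin k) ℂ} (h : ∀ s, quad H s ≤ c * ∑ j, ‖s j‖ ^ 2) (n : ℕ) :
    stateCost Q a π H n ≤
      ENNReal.ofReal c * ∫⁻ ω, ENNReal.ofReal (∑ j, ‖closedLoop a π ω n j‖ ^ 2) ∂Q := by
  rw [stateCost, ← lintegral_const_mul' _ _ ENNReal.ofReal_ne_top]
  refine lintegral_mono fun ω => ?_
  rw [← ENNReal.ofReal_mul hc]
  exact ENNReal.ofReal_le_ofReal (h _)

theorem trace_le_add_controlPower (hG : IsStabilizingDARESolution a G) {π : Control k}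
    (hπ : ∀ i, Measurable (π i)) {n : ℕ} (hn : n ≠ 0) :
    ENNReal.ofReal G.trace.re ≤ stateCost (sampleLaw k) a π G n / n + controlPower a π n := by
  have h := stateCost_add_trace_le_sum hG hπ (n := n) fun t _ => whiteAt_sampleLaw (k := k) t
  have hn' : (n : ℝ≥0∞) ≠ 0 := by exact_mod_cast hn
  rw [controlPower_eq, ← ENNReal.add_div, ENNReal.le_div_iff_mul_le (Or.inl hn')
    (Or.inl (ENNReal.natCast_ne_top n)), mul_comm]
  exact le_add_self.trans h

theorem controlPower_lqgControl_le (hG : IsStabilizingDARESolution a G) {n : ℕ} (hn : n ≠ 0) :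
    controlPower a (lqgControl a G) n ≤
      stateCost (sampleLaw k) a (lqgControl a G) G 0 / n + ENNReal.ofReal G.trace.re := by
  have h := stateCost_add_sum_lqgControl hG (n := n) fun t _ => whiteAt_sampleLaw (k := k) t
  have hn' : (n : ℝ≥0∞) ≠ 0 := by exact_mod_cast hn
  rw [controlPower_eq]
  refine ENNReal.div_le_of_le_mul ?_
  rw [add_mul, ENNReal.div_mul_cancel hn' (ENNReal.natCast_ne_top n),
    mul_comm (ENNReal.ofReal _)]
  exact le_add_self.trans h.le

/-- Stabilization bounds E S'GS eventually, so after division by n the final potential disappears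
from the telescoped inequality. Bounding the liminf yields convergence for the LQG control as well
as optimality. -/
theorem le_limsup_controlPower (hG : IsStabilizingDARESolution a G) {π : Control k}
    (hπ : ∀ i, Measurable (π i)) (hs : Stabilizes a π) :
    ENNReal.ofReal G.trace.re ≤ liminf (controlPower a π) atTop := by
  obtain ⟨c, hc, hquad⟩ := exists_quad_le G
  obtain ⟨K, hK1, hK2⟩ := exists_between hs
  have hev := eventually_lt_of_limsup_lt hK1
  have ht := (tendsto_const_div_natCast (c := ENNReal.ofReal c * K)
    (ENNReal.mul_ne_top ENNReal.ofReal_ne_top hK2.ne))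
  have ht2 := (ENNReal.Tendsto.sub (tendsto_const_nhds (x := ENNReal.ofReal G.trace.re)) ht
    (Or.inl ENNReal.ofReal_ne_top))
  rw [tsub_zero] at ht2
  rw [← ht2.liminf_eq]
  refine liminf_le_liminf ?_
  filter_upwards [hev, eventually_ne_atTop 0] with n hn hn0
  rw [tsub_le_iff_left]
  refine (trace_le_add_controlPower hG hπ hn0).trans ?_
  gcongr
  refine (stateCost_le hc hquad n).trans ?_
  gcongr

theorem stateCost_zero_ne_top (π : Control k) (H : Matrix (Fin k) (Fin k) ℂ) :
    stateCost (sampleLaw k) a π H 0 ≠ ⊤ := by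
  obtain ⟨c, hc, hquad⟩ := exists_quad_le H
  refine ((stateCost_le hc hquad 0).trans_lt (ENNReal.mul_lt_top ENNReal.ofReal_lt_top ?_)).ne
  refine lt_of_le_of_lt lintegral_norm_sq_initial_le ?_
  exact ENNReal.mul_lt_top (ENNReal.natCast_lt_top k) (by simp)

theorem limsup_controlPower_lqgControl_le (hG : IsStabilizingDARESolution a G) :
    limsup (controlPower a (lqgControl a G)) atTop ≤ ENNReal.ofReal G.trace.re := by
  have ht := (tendsto_const_div_natCast (stateCost_zero_ne_top (a := a) (lqgControl a G) G)).add
    (tendsto_const_nhds (x := ENNReal.ofReal G.trace.re))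
  rw [zero_add] at ht
  rw [← ht.limsup_eq]
  refine limsup_le_limsup ?_
  filter_upwards [eventually_ne_atTop 0] with n hn
  exact controlPower_lqgControl_le hG hn

theorem tendsto_controlPower_lqgControl (hG : IsStabilizingDARESolution a G) (hα : 1 < α)
    (ha : ∀ j, ‖a j‖ = α) :
    Tendsto (controlPower a (lqgControl a G)) atTop (𝓝 (ENNReal.ofReal G.trace.re)) :=
  tendsto_of_le_liminf_of_limsup_le
    (le_limsup_controlPower hG measurable_lqgControl (stabilizes_lqgControl hG hα ha))
    (limsup_controlPower_lqgControl_le hG)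

theorem isMinimumPowerControl_lqgControl (hG : IsStabilizingDARESolution a G) (hα : 1 < α)
    (ha : ∀ j, ‖a j‖ = α) : IsMinimumPowerControl a (lqgControl a G) :=
  ⟨stabilizes_lqgControl hG hα ha, fun _ hπ hs => (limsup_controlPower_lqgControl_le hG).trans
    ((le_limsup_controlPower hG hπ hs).trans (liminf_le_limsup))⟩

/-! ### Mean square error -/

/-- Plant and receiver obey the same linear recursion with the same input; they differ only in the
initial value, which the pole amplifies. Hence the estimation error is the state divided by a_j^n.
-/
theorem plantState_eq (a θ : Fin k → ℂ) (y : ℕ → Fin k → ℂ) (n : ℕ) (j : Fin k) :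
    plantState a θ y n j = a j ^ n * θ j + receiverState (a j) (fun i => y i j) n := by
  induction n with
  | zero => simp [plantState, receiverState]
  | succ n ih =>
    simp only [plantState, receiverState, ih]
    ring

theorem plantState_channelOutput (π : Control k) (ω : Sample k) (n : ℕ) :
    plantState a ω.1 (channelOutput a π ω) n = closedLoop a π ω n := by
  induction n with
  | zero => rfl
  | succ n ih =>
    funext j
    simp only [plantState, closedLoop, ih, channelOutput]

theorem sub_receiverEstimate (θ : Fin k → ℂ) (y : ℕ → Fin k → ℂ) (n : ℕ) {j : Fin k}
    (ha : a j ≠ 0) :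
    θ j - receiverEstimate (a j) (fun i => y i j) n = (a j ^ n)⁻¹ * plantState a θ y n j := by
  rw [receiverEstimate, plantState_eq, mul_add, inv_mul_cancel_left₀ (pow_ne_zero n ha)]
  ring

theorem meanSquareError_eq (hα : 0 < α) (ha : ∀ j, ‖a j‖ = α) (π : Control k) (j : Fin k)
    (n : ℕ) :
    meanSquareError a π j n = ENNReal.ofReal ((α ^ 2)⁻¹ ^ n) *
      ∫⁻ ω, ENNReal.ofReal (‖closedLoop a π ω n j‖ ^ 2) ∂(sampleLaw k) := by
  have haj : a j ≠ 0 := norm_pos_iff.1 (by rw [ha]; exact hα)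
  rw [meanSquareError, ← lintegral_const_mul' _ _ ENNReal.ofReal_ne_top]
  refine lintegral_congr fun ω => ?_
  rw [sub_receiverEstimate ω.1 (channelOutput a π ω) n haj, plantState_channelOutput,
    ← ENNReal.ofReal_mul (by positivity), norm_mul, norm_inv, norm_pow, ha, mul_pow]
  congr 2
  rw [inv_pow, inv_pow, ← pow_mul, ← pow_mul, mul_comm]

/-- The mean square error is α^(−2n) V_n, and V_n lies between two positive constants for n ≥ 1, so
only the exponential factor survives in the exponent. -/
theorem hasMSEExponent_lqgControl (hG : IsStabilizingDARESolution a G) (hα : 1 < α)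
    (ha : ∀ j, ‖a j‖ = α) (j : Fin k) :
    HasMSEExponent a (lqgControl a G) j (Real.logb 2 α) := by
  have hα0 : 0 < α := by linarith
  obtain ⟨K, hK, hbound⟩ := exists_secondMoment_le_sampleLaw hG hα ha
  set V : ℕ → ℝ≥0∞ := fun n =>
    ∫⁻ ω, ENNReal.ofReal (‖closedLoop a (lqgControl a G) ω n j‖ ^ 2) ∂(sampleLaw k) with hV
  have hVK : ∀ n, V n ≤ K := fun n => (lintegral_mono fun ω =>
    ENNReal.ofReal_le_ofReal (sum_sq_single_le _ j)).trans (hbound n)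
  have hVtop : ∀ n, V n ≠ ⊤ := fun n => ((hVK n).trans_lt hK.lt_top).ne
  -- The latest noise is independent of the rest of the state and contributes its full unit
  -- variance.
  have hV1 : ∀ n, 1 ≤ V (n + 1) := by
    intro n
    have hps : (Matrix.single j j (1 : ℂ)).PosSemidef := by
      have := posSemidef_conjTranspose_mul_self (Matrix.single j j (1 : ℂ))
      simpa using this
    have h := (whiteAt_sampleLaw (k := k) n).lintegral_quad_succ (a := a)
      (π := lqgControl a G) measurable_lqgControl hps
    have e : V (n + 1) = ∫⁻ ω, ENNReal.ofReal (quad (Matrix.single j j 1)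
        (closedLoop a (lqgControl a G) ω (n + 1))) ∂(sampleLaw k) := by
      simp only [hV, quad_single]
    rw [e, h]
    have : ENNReal.ofReal (Matrix.single j j (1 : ℂ)).trace.re = 1 := by simp
    rw [this]
    exact le_add_self
  refine ⟨fun n => ?_, ?_⟩
  · rw [meanSquareError_eq hα0 ha]
    exact ENNReal.mul_ne_top ENNReal.ofReal_ne_top (hVtop n)
  · have hlog : Tendsto (fun n : ℕ => Real.logb 2 α - 1 / (2 * (n : ℝ)) *
        Real.logb 2 (V n).toReal) atTop (𝓝 (Real.logb 2 α)) := by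
      have h0 : Tendsto (fun n : ℕ => 1 / (2 * (n : ℝ)) * Real.logb 2 (V n).toReal) atTop
          (𝓝 0) := by
        have hl : Tendsto (fun n : ℕ => 1 / (2 * (n : ℝ)) * Real.logb 2 K.toReal) atTop
            (𝓝 (0 * Real.logb 2 K.toReal)) := by
          refine Tendsto.mul_const _ ?_
          have := (tendsto_const_div_atTop_nhds_zero_nat (1 / 2 : ℝ))
          refine this.congr fun n => ?_
          rw [div_div]
        rw [zero_mul] at hl
        refine tendsto_of_tendsto_of_tendsto_of_le_of_le' tendsto_const_nhds hl ?_ ?_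
        · filter_upwards [eventually_ne_atTop 0] with n hn
          obtain ⟨m, rfl⟩ := Nat.exists_eq_succ_of_ne_zero hn
          have : 1 ≤ (V (m + 1)).toReal := by
            rw [← ENNReal.toReal_one]
            exact ENNReal.toReal_mono (hVtop _) (hV1 m)
          exact mul_nonneg (by positivity) (Real.logb_nonneg (by norm_num) this)
        · filter_upwards [eventually_ne_atTop 0] with n hn
          obtain ⟨m, rfl⟩ := Nat.exists_eq_succ_of_ne_zero hn
          have : 1 ≤ (V (m + 1)).toReal := by
            rw [← ENNReal.toReal_one]
            exact ENNReal.toReal_mono (hVtop _) (hV1 m)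
          gcongr
          · norm_num
          · exact hVK _
      simpa using (tendsto_const_nhds (x := Real.logb 2 α)).sub h0
    refine hlog.congr' ?_
    filter_upwards [eventually_ne_atTop 0] with n hn
    obtain ⟨m, rfl⟩ := Nat.exists_eq_succ_of_ne_zero hn
    have h1 : 1 ≤ (V (m + 1)).toReal := by
      rw [← ENNReal.toReal_one]
      exact ENNReal.toReal_mono (hVtop _) (hV1 m)
    rw [meanSquareError_eq hα0 ha, ENNReal.toReal_mul, ENNReal.toReal_ofReal (by positivity),
      Real.logb_mul (by positivity) (by linarith : (V (m + 1)).toReal ≠ 0),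
      Real.logb_pow, Real.logb_inv, Real.logb_pow]
    have : ((m.succ : ℕ) : ℝ) ≠ 0 := by positivity
    push_cast at this ⊢
    field_simp
    ring

end GaussianBC

namespace GaussianBC

open Matrix FeedbackCode

variable {k n : ℕ}

/-! ### The complex system inside the real channel -/

/-- The initial state `θ` together with the complex noise given by the real noise `z`. -/
noncomputable def noiseSample (θ : Fin k → ℂ) (z : Fin n → Fin k → ℝ) : Sample k :=
  (θ, fun s j => pairOutputs (fun l => z l j) s)

theorem pairOutputs_of_lt (y : Fin n → ℝ) {s : ℕ} (h : 2 * s + 1 < n) :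
    pairOutputs y s = (⟨y ⟨2 * s, by omega⟩ / √2, y ⟨2 * s + 1, h⟩ / √2⟩ : ℂ) :=
  dif_pos h

theorem measurable_pairOutputs (s : ℕ) : Measurable fun y : Fin n → ℝ => pairOutputs y s := by
  unfold pairOutputs
  split_ifs with h
  · have hm : Measurable fun y : Fin n → ℝ => (y ⟨2 * s, by omega⟩ / √2, y ⟨2 * s + 1, h⟩ / √2) :=
      ((measurable_pi_apply _).div_const _).prodMk ((measurable_pi_apply _).div_const _)
    exact measurable_complexMk.comp hm
  · exact measurable_const

theorem measurable_noiseSample (θ : Fin k → ℂ) :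
    Measurable (noiseSample (n := n) θ) := by
  refine measurable_const.prodMk (measurable_pi_lambda _ fun s => measurable_pi_lambda _ fun j => ?_)
  have hm : Measurable fun (z : Fin n → Fin k → ℝ) (l : Fin n) => z l j :=
    measurable_pi_lambda _ fun l => (measurable_pi_apply j).comp (measurable_pi_apply l)
  exact (measurable_pairOutputs s).comp hm

instance : IsProbabilityMeasure (noiseLaw k n) := by
  unfold noiseLaw
  infer_instance

/-- The law of the complex sample that the real channel provides, for message points `θ`. -/
noncomputable def realLaw (n : ℕ) (θ : Fin k → ℂ) : Measure (Sample k) :=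
  (noiseLaw k n).map (noiseSample θ)

instance (θ : Fin k → ℂ) : IsProbabilityMeasure (realLaw n θ) :=
  Measure.isProbabilityMeasure_map (measurable_noiseSample θ).aemeasurable

theorem integral_noise (l : Fin n) (j : Fin k) : ∫ z, z l j ∂(noiseLaw k n) = 0 := by
  have h1 : ∫ z, z l j ∂(noiseLaw k n) =
      ∫ x : Fin k → ℝ, x j ∂(Measure.pi fun _ => gaussianReal 0 1) :=
    integral_comp_eval (μ := fun _ : Fin n => Measure.pi fun _ : Fin k => gaussianReal 0 1)
      (f := fun x : Fin k → ℝ => x j) (measurable_pi_apply j).aestronglyMeasurable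
  rw [h1]
  exact (integral_comp_eval (μ := fun _ : Fin k => gaussianReal 0 1) (f := fun x : ℝ => x)
    measurable_id.aestronglyMeasurable).trans integral_id_gaussianReal

theorem integral_noise_mul (l l' : Fin n) (i j : Fin k) :
    ∫ z, z l i * z l' j ∂(noiseLaw k n) = if l = l' ∧ i = j then 1 else 0 := by
  have h0 : ∀ i : Fin k, ∫ x : Fin k → ℝ, x i ∂(Measure.pi fun _ => gaussianReal 0 1) = 0 :=
    fun i => (integral_comp_eval (μ := fun _ : Fin k => gaussianReal 0 1) (f := fun x : ℝ => x)
      measurable_id.aestronglyMeasurable).trans integral_id_gaussianReal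
  rw [noiseLaw, integral_pi_mul _ (f := fun x : Fin k → ℝ => x i) (g := fun x : Fin k → ℝ => x j)
    (measurable_pi_apply i) (measurable_pi_apply j),
    integral_pi_mul _ (f := fun x : ℝ => x) (g := fun x : ℝ => x) measurable_id measurable_id,
    integral_sq_gaussianReal, integral_id_gaussianReal, h0]
  by_cases h1 : l = l' <;> by_cases h2 : i = j <;> simp [h1, h2]

theorem memLp_noise (l : Fin n) (j : Fin k) : MemLp (fun z => z l j) 2 (noiseLaw k n) :=
  (memLp_two_gaussianReal 1).comp_measurePreserving
    ((measurePreserving_eval (fun _ : Fin k => gaussianReal 0 1) j).comp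
      (measurePreserving_eval (fun _ : Fin n => Measure.pi fun _ : Fin k => gaussianReal 0 1) l))

theorem isWhite_realLaw (θ : Fin k → ℂ) {t : ℕ} (ht : 2 * t + 1 < n) :
    IsWhite ((realLaw n θ).map fun ω => ω.2 t) := by
  rw [realLaw, Measure.map_map (measurable_noise t) (measurable_noiseSample θ)]
  have e : ((fun ω : Sample k => ω.2 t) ∘ noiseSample (n := n) θ) = fun z j =>
      (⟨z ⟨2 * t, by omega⟩ j / √2, z ⟨2 * t + 1, ht⟩ j / √2⟩ : ℂ) := by
    funext z j
    exact pairOutputs_of_lt (fun l => z l j) ht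
  have hm : ∀ (l : Fin n) (j : Fin k), Measurable fun z : Fin n → Fin k → ℝ => z l j / √2 :=
    fun l j => ((measurable_pi_apply j).comp (measurable_pi_apply l)).div_const _
  have hL : ∀ (l : Fin n) (j : Fin k), MemLp (fun z => z l j / √2) 2 (noiseLaw k n) := fun l j => by
    simp only [div_eq_mul_inv]
    exact (memLp_noise l j).mul_const _
  have h1 : ∀ (l : Fin n) (j : Fin k), ∫ z, z l j / √2 ∂(noiseLaw k n) = 0 := fun l j => by
    rw [integral_div, integral_noise, zero_div]
  have h2 : ∀ (l l' : Fin n) (i j : Fin k), ∫ z, z l i / √2 * (z l' j / √2) ∂(noiseLaw k n) =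
      if l = l' ∧ i = j then 1 / 2 else 0 := fun l l' i j => by
    have : ∀ z : Fin n → Fin k → ℝ, z l i / √2 * (z l' j / √2) = z l i * z l' j / 2 := fun z => by
      rw [div_mul_div_comm, Real.mul_self_sqrt zero_le_two]
    simp only [this]
    rw [integral_div, integral_noise_mul]
    split_ifs <;> norm_num
  rw [e]
  refine isWhite_of_re_im (fun j => hm _ j) (fun j => hm _ j) (fun j => hL _ j) (fun j => hL _ j)
    (fun j => h1 _ j) (fun j => h1 _ j) (fun i j => ?_) (fun i j => ?_) (fun i j => ?_)
  · rw [h2]; simp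
  · rw [h2]; simp
  · rw [h2]; simp

/-- Restriction of the noise to a set of times, padded by zero. -/
noncomputable def padNoise (S : Finset (Fin n)) (r : S → Fin k → ℝ) : Fin n → Fin k → ℝ :=
  fun l => if h : l ∈ S then r ⟨l, h⟩ else 0

theorem measurable_padNoise (S : Finset (Fin n)) : Measurable (padNoise (k := k) S) := by
  refine measurable_pi_lambda _ fun l => ?_
  unfold padNoise
  split_ifs
  · exact measurable_pi_apply _
  · exact measurable_const

theorem measurable_past (t : ℕ) : Measurable (past (k := k) t) := by
  refine measurable_fst.prodMk (measurable_pi_lambda _ fun i => ?_)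
  split_ifs
  · exact measurable_noise i
  · exact measurable_const

theorem indepFun_map_of_indepFun_comp {Ω Ω' β γ : Type*} [MeasurableSpace Ω] [MeasurableSpace Ω']
    [MeasurableSpace β] [MeasurableSpace γ] {Q : Measure Ω} [IsProbabilityMeasure Q] {h : Ω → Ω'}
    {f : Ω' → β} {g : Ω' → γ} (hh : Measurable h) (hf : Measurable f) (hg : Measurable g)
    (hI : IndepFun (f ∘ h) (g ∘ h) Q) : IndepFun f g (Q.map h) := by
  have := Measure.isProbabilityMeasure_map (μ := Q) hh.aemeasurable
  rw [indepFun_iff_map_prod_eq_prod_map_map hf.aemeasurable hg.aemeasurable,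
    Measure.map_map (hf.prodMk hg) hh, Measure.map_map hf hh, Measure.map_map hg hh]
  exact (indepFun_iff_map_prod_eq_prod_map_map (hf.comp hh).aemeasurable
    (hg.comp hh).aemeasurable).1 hI

/-- The complex past at time t depends only on real times below 2t, and the noise at t only on real
times from 2t on. Restriction to these disjoint sets, padded by zero, exhibits both as functions of
independent families. -/
theorem whiteAt_realLaw (θ : Fin k → ℂ) {t : ℕ} (ht : 2 * t + 1 < n) :
    WhiteAt (realLaw n θ) t := by
  refine ⟨?_, isWhite_realLaw θ ht⟩
  refine indepFun_map_of_indepFun_comp (measurable_noiseSample θ) (measurable_past t)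
    (measurable_noise t) ?_
  set S : Finset (Fin n) := Finset.univ.filter fun l => (l : ℕ) < 2 * t with hS
  set T : Finset (Fin n) := Finset.univ.filter fun l => 2 * t ≤ (l : ℕ) with hT
  have hI : iIndepFun (fun (l : Fin n) (z : Fin n → Fin k → ℝ) => z l) (noiseLaw k n) :=
    iIndepFun_pi (X := fun _ : Fin n => (id : (Fin k → ℝ) → Fin k → ℝ)) fun _ => aemeasurable_id
  have hd : Disjoint S T := by
    rw [Finset.disjoint_left]
    intro l h1 h2
    rw [hS, Finset.mem_filter] at h1
    rw [hT, Finset.mem_filter] at h2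
    omega
  have h := (hI.indepFun_finset S T hd fun l => measurable_pi_apply l).comp
    ((measurable_past t).comp ((measurable_noiseSample θ).comp (measurable_padNoise S)))
    ((measurable_noise t).comp ((measurable_noiseSample θ).comp (measurable_padNoise T)))
  have e1 : (past t ∘ noiseSample θ ∘ padNoise S) ∘ (fun (z : Fin n → Fin k → ℝ) (l : S) => z l) =
      past t ∘ noiseSample θ := by
    funext z
    refine Prod.ext rfl (funext fun s => ?_)
    simp only [past, Function.comp, noiseSample]
    split_ifs with hs
    · funext j
      have h2 : 2 * s + 1 < n := by omega
      rw [pairOutputs_of_lt _ h2, pairOutputs_of_lt _ h2]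
      have m1 : (⟨2 * s, by omega⟩ : Fin n) ∈ S := by simp [hS]; omega
      have m2 : (⟨2 * s + 1, h2⟩ : Fin n) ∈ S := by simp [hS]; omega
      simp only [padNoise, dif_pos m1, dif_pos m2]
    · rfl
  have e2 : ((fun ω : Sample k => ω.2 t) ∘ noiseSample θ ∘ padNoise T) ∘
      (fun (z : Fin n → Fin k → ℝ) (l : T) => z l) = (fun ω => ω.2 t) ∘ noiseSample θ := by
    funext z j
    simp only [Function.comp, noiseSample]
    rw [pairOutputs_of_lt _ ht, pairOutputs_of_lt _ ht]
    have m1 : (⟨2 * t, by omega⟩ : Fin n) ∈ T := by simp [hT]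
    have m2 : (⟨2 * t + 1, ht⟩ : Fin n) ∈ T := by simp [hT]
    simp only [padNoise, dif_pos m1, dif_pos m2]
  rwa [e1, e2] at h

/-! ### Codes given by a control -/

variable {M : Fin k → ℕ} {a : Fin k → ℂ} {π : Control k}

theorem plantState_congr (a θ : Fin k → ℂ) {y y' : ℕ → Fin k → ℂ} {t : ℕ}
    (h : ∀ s < t, y s = y' s) : plantState a θ y t = plantState a θ y' t := by
  induction t with
  | zero => rfl
  | succ t ih =>
    funext j
    simp only [plantState, ih fun s hs => h s (hs.trans t.lt_succ_self), h t t.lt_succ_self]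

theorem receiverState_congr (a : ℂ) {y y' : ℕ → ℂ} {t : ℕ}
    (h : ∀ s < t, y s = y' s) : receiverState a y t = receiverState a y' t := by
  induction t with
  | zero => rfl
  | succ t ih =>
    simp only [receiverState, ih fun s hs => h s (hs.trans t.lt_succ_self), h t t.lt_succ_self]

/-- The real symbol sent at time `i`, in terms of the complex closed loop. -/
noncomputable def realSymbol (a : Fin k → ℂ) (π : Control k) (n : ℕ) (ω : Sample k) (i : ℕ) : ℝ :=
  if 2 * (i / 2) + 1 < n then
    √2 * (if i % 2 = 0 then (π (i / 2) (closedLoop a π ω (i / 2))).re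
      else (π (i / 2) (closedLoop a π ω (i / 2))).im)
  else 0

theorem output_eq (c : FeedbackCode k n M) (m : (j : Fin k) → Fin (M j))
    (z : Fin n → Fin k → ℝ) (i : Fin n) (j : Fin k) :
    c.output m z i j = c.input m z i + z i j := by
  rw [FeedbackCode.output, FeedbackCode.input]

theorem complex_output_eq (c : FeedbackCode k n M) {m : (j : Fin k) → Fin (M j)}
    {z : Fin n → Fin k → ℝ} {θ : Fin k → ℂ} {s : ℕ} (hs : 2 * s + 1 < n)
    (h1 : c.input m z ⟨2 * s, by omega⟩ = realSymbol a π n (noiseSample θ z) (2 * s))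
    (h2 : c.input m z ⟨2 * s + 1, hs⟩ = realSymbol a π n (noiseSample θ z) (2 * s + 1))
    (j : Fin k) :
    (⟨c.output m z ⟨2 * s, by omega⟩ j / √2, c.output m z ⟨2 * s + 1, hs⟩ j / √2⟩ : ℂ) =
      channelOutput a π (noiseSample θ z) s j := by
  have d1 : 2 * s / 2 = s := by omega
  have d2 : (2 * s + 1) / 2 = s := by omega
  have d3 : 2 * s % 2 = 0 := by omega
  have d4 : ¬ (2 * s + 1) % 2 = 0 := by omega
  rw [realSymbol, d1, if_pos hs, if_pos d3] at h1
  rw [realSymbol, d2, if_pos hs, if_neg d4] at h2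
  have h2' : √2 ≠ 0 := by positivity
  have hz : (noiseSample θ z).2 s j = pairOutputs (fun l => z l j) s := rfl
  rw [output_eq, output_eq, h1, h2, channelOutput, hz, pairOutputs_of_lt _ hs]
  apply Complex.ext
  · rw [Complex.add_re, add_div, mul_div_cancel_left₀ _ h2']
  · rw [Complex.add_im]
    simp only
    rw [add_div, mul_div_cancel_left₀ _ h2']

/-- By strong induction on time the encoder, which sees only real outputs, reproduces the complex
closed loop, so the results on that loop transfer to the code. -/
theorem IsControlCode.input_eq {θ : (j : Fin k) → Fin (M j) → ℂ} {c : FeedbackCode k n M}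
    (hc : IsControlCode a π θ c) (m : (j : Fin k) → Fin (M j)) (z : Fin n → Fin k → ℝ) (i : Fin n) :
    c.input m z i = realSymbol a π n (noiseSample (fun j => θ j (m j)) z) i := by
  obtain ⟨i, hi⟩ := i
  induction i using Nat.strong_induction_on with
  | _ i ih =>
    rw [FeedbackCode.input, hc.1, realSymbol]
    have key : plantState a (fun j => θ j (m j)) (fun s j => pairOutputs
        (fun l : Fin i => c.output m z ⟨(l : ℕ), l.2.trans hi⟩ j) s) (i / 2) =
        closedLoop a π (noiseSample (fun j => θ j (m j)) z) (i / 2) := by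
      rw [← plantState_channelOutput]
      refine plantState_congr _ _ fun s hs => funext fun j => ?_
      -- Every pair s < i/2 is complete before time i, so the default value 0 of `pairOutputs` is
      -- never met.
      have h1 : 2 * s + 1 < i := by omega
      rw [pairOutputs_of_lt _ h1]
      exact complex_output_eq c (h1.trans hi) (ih _ (by omega) _) (ih _ h1 _) j
    simp only [key]

theorem IsControlCode.sub_receiverEstimate {θ : (j : Fin k) → Fin (M j) → ℂ}
    {c : FeedbackCode k n M} (hc : IsControlCode a π θ c) (m : (j : Fin k) → Fin (M j))
    (z : Fin n → Fin k → ℝ) {j : Fin k} (ha : a j ≠ 0) :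
    θ j (m j) - receiverEstimate (a j) (pairOutputs fun i => c.output m z i j) (n / 2) =
      (a j ^ (n / 2))⁻¹ *
        closedLoop a π (noiseSample (fun j => θ j (m j)) z) (n / 2) j := by
  set ω := noiseSample (fun j => θ j (m j)) z
  have h : receiverEstimate (a j) (pairOutputs fun i => c.output m z i j) (n / 2) =
      receiverEstimate (a j) (fun s => channelOutput a π ω s j) (n / 2) := by
    rw [receiverEstimate, receiverEstimate]
    congr 1
    refine receiverState_congr _ fun s hs => ?_
    have h1 : 2 * s + 1 < n := by omega
    rw [pairOutputs_of_lt _ h1]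
    exact complex_output_eq c h1 (hc.input_eq m z _) (hc.input_eq m z _) j
  rw [h, ← plantState_channelOutput]
  exact GaussianBC.sub_receiverEstimate (fun j => θ j (m j)) (channelOutput a π ω) (n / 2) ha

end GaussianBC

namespace GaussianBC

open Matrix FeedbackCode

variable {k n : ℕ} {M : Fin k → ℕ} {a : Fin k → ℂ} {π : Control k}

/-! ### Existence of the codes -/

theorem measurable_plantState {Ω : Type*} [MeasurableSpace Ω] (a θ : Fin k → ℂ)
    {y : Ω → ℕ → Fin k → ℂ} (hy : ∀ s j, Measurable fun ω => y ω s j) (t : ℕ) :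
    Measurable fun ω => plantState a θ (y ω) t := by
  induction t with
  | zero => exact measurable_const
  | succ t ih =>
    refine measurable_pi_lambda _ fun j => ?_
    simp only [plantState]
    exact (((measurable_pi_apply j).comp ih).const_mul _).add (hy t j)

theorem measurable_receiverState {Ω : Type*} [MeasurableSpace Ω] (a : ℂ)
    {y : Ω → ℕ → ℂ} (hy : ∀ s, Measurable fun ω => y ω s) (t : ℕ) :
    Measurable fun ω => receiverState a (y ω) t := by
  induction t with
  | zero => exact measurable_const
  | succ t ih =>
    simp only [receiverState]
    exact (ih.const_mul _).add (hy t)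

/-- A measurable choice of a closest point in a finite family. -/
theorem exists_measurable_nearest {Ω : Type*} [MeasurableSpace Ω] {N : ℕ} (hN : 0 < N)
    (p : Fin N → ℂ) {f : Ω → ℂ} (hf : Measurable f) :
    ∃ d : Ω → Fin N, Measurable d ∧ ∀ y m, ‖p (d y) - f y‖ ≤ ‖p m - f y‖ := by
  classical
  let P : Ω → Finset (Fin N) := fun y =>
    Finset.univ.filter fun m => ∀ m', ‖p m - f y‖ ≤ ‖p m' - f y‖
  have hP : ∀ y, (P y).Nonempty := fun y => by
    obtain ⟨m, -, hm⟩ := Finset.exists_min_image Finset.univ (fun m => ‖p m - f y‖)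
      ⟨⟨0, hN⟩, Finset.mem_univ _⟩
    exact ⟨m, Finset.mem_filter.2 ⟨Finset.mem_univ _, fun m' => hm m' (Finset.mem_univ _)⟩⟩
  have hPm : ∀ m, MeasurableSet {y | m ∈ P y} := fun m => by
    have : {y | m ∈ P y} = ⋂ m', {y | ‖p m - f y‖ ≤ ‖p m' - f y‖} := by
      ext y; simp [P]
    rw [this]
    exact MeasurableSet.iInter fun m' =>
      measurableSet_le (measurable_const.sub hf).norm (measurable_const.sub hf).norm
  -- Ties are broken by the least index, which keeps the choice measurable.
  refine ⟨fun y => (P y).min' (hP y), measurable_to_countable' fun m => ?_, fun y m => ?_⟩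
  · have : (fun y => (P y).min' (hP y)) ⁻¹' {m} =
        {y | m ∈ P y} ∩ ⋂ m' : Fin N, {y | m' ∈ P y → m ≤ m'} := by
      ext y
      simp only [Set.mem_preimage, Set.mem_singleton_iff, Set.mem_inter_iff, Set.mem_ofPred_eq,
        Set.mem_iInter]
      constructor
      · rintro rfl
        exact ⟨Finset.min'_mem _ _, fun m' hm' => Finset.min'_le _ _ hm'⟩
      · rintro ⟨h1, h2⟩
        exact le_antisymm (Finset.min'_le _ _ h1) (h2 _ (Finset.min'_mem _ _))
    rw [this]
    refine (hPm m).inter (MeasurableSet.iInter fun m' => ?_)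
    by_cases h : m ≤ m'
    · simp [h]
    · have : {y | m' ∈ P y → m ≤ m'} = {y | m' ∈ P y}ᶜ := by
        ext y; simp [h]
      rw [this]
      exact (hPm m').compl
  · exact (Finset.mem_filter.1 (Finset.min'_mem _ (hP y))).2 m

theorem exists_isControlCode (hπ : ∀ i, Measurable (π i)) (hM : ∀ j, 0 < M j)
    (θ : (j : Fin k) → Fin (M j) → ℂ) : ∃ c : FeedbackCode k n M, IsControlCode a π θ c := by
  have hest : ∀ j, Measurable fun y : Fin n → ℝ =>
      receiverEstimate (a j) (pairOutputs y) (n / 2) := fun j =>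
    (measurable_receiverState (a j) measurable_pairOutputs (n / 2)).const_mul _
  choose d hd1 hd2 using fun j => exists_measurable_nearest (hM j) (θ j) (hest j)
  have hsym : ∀ (i : Fin n) (m : (j : Fin k) → Fin (M j)),
      Measurable fun y : Fin (i : ℕ) → Fin k → ℝ => π ((i : ℕ) / 2) (plantState a
        (fun j => θ j (m j)) (fun s j => pairOutputs (fun l => y l j) s) ((i : ℕ) / 2)) := by
    intro i m
    refine (hπ _).comp (measurable_plantState _ _ (fun s j => ?_) _)
    have hm : Measurable fun (z : Fin (i : ℕ) → Fin k → ℝ) (l : Fin (i : ℕ)) => z l j :=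
      measurable_pi_lambda _ fun l => (measurable_pi_apply j).comp (measurable_pi_apply l)
    exact (measurable_pairOutputs s).comp hm
  refine ⟨⟨fun i m y => if 2 * ((i : ℕ) / 2) + 1 < n then
        √2 * (if (i : ℕ) % 2 = 0 then
          (π ((i : ℕ) / 2) (plantState a (fun j => θ j (m j))
            (fun s j => pairOutputs (fun l => y l j) s) ((i : ℕ) / 2))).re
        else
          (π ((i : ℕ) / 2) (plantState a (fun j => θ j (m j))
            (fun s j => pairOutputs (fun l => y l j) s) ((i : ℕ) / 2))).im)
      else 0, d, fun i m => ?_, hd1⟩, fun _ _ _ => rfl, fun j y m => hd2 j y m⟩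
  split_ifs
  · exact (Complex.measurable_re.comp (hsym i m)).const_mul _
  · exact (Complex.measurable_im.comp (hsym i m)).const_mul _
  · exact measurable_const

/-! ### Power of the codes -/

theorem sum_range_two_mul {R : Type*} [AddCommMonoid R] (g : ℕ → R) (N : ℕ) :
    ∑ i ∈ Finset.range (2 * N), g i = ∑ t ∈ Finset.range N, (g (2 * t) + g (2 * t + 1)) := by
  induction N with
  | zero => simp
  | succ N ih =>
    rw [show 2 * (N + 1) = 2 * N + 1 + 1 by ring, Finset.sum_range_succ, Finset.sum_range_succ, ih,
      Finset.sum_range_succ, add_assoc]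

theorem ENNReal_sum_div_card_le {ι : Type*} [Fintype ι] (f : ι → ℝ≥0∞) {B : ℝ≥0∞}
    (h : ∀ m, f m ≤ B) : (∑ m, f m) / (Fintype.card ι : ℝ≥0∞) ≤ B := by
  refine ENNReal.div_le_of_le_mul ?_
  calc ∑ m, f m ≤ ∑ _m : ι, B := Finset.sum_le_sum fun m _ => h m
    _ = B * Fintype.card ι := by
      rw [Finset.sum_const, nsmul_eq_mul, mul_comm, Finset.card_univ]

/-- The two real symbols of a pair have squares adding up to 2|X|², and for odd n the unpaired last
transmission is idle. -/
theorem IsControlCode.sum_lintegral_input_sq (hπ : ∀ i, Measurable (π i))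
    {θ : (j : Fin k) → Fin (M j) → ℂ} {c : FeedbackCode k n M} (hc : IsControlCode a π θ c)
    (m : (j : Fin k) → Fin (M j)) :
    ∑ i : Fin n, ∫⁻ z, ENNReal.ofReal (c.input m z i ^ 2) ∂(noiseLaw k n) =
      2 * ∑ t ∈ Finset.range (n / 2), symbolPower (realLaw n fun j => θ j (m j)) a π t := by
  set θm := fun j => θ j (m j) with hθ
  set g : ℕ → ℝ≥0∞ := fun i =>
    ∫⁻ z, ENNReal.ofReal (realSymbol a π n (noiseSample θm z) i ^ 2) ∂(noiseLaw k n) with hg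
  have h1 : ∑ i : Fin n, ∫⁻ z, ENNReal.ofReal (c.input m z i ^ 2) ∂(noiseLaw k n) =
      ∑ i ∈ Finset.range n, g i := by
    rw [← Fin.sum_univ_eq_sum_range]
    refine Finset.sum_congr rfl fun i _ => ?_
    simp only [hg, hc.input_eq]
    rfl
  have h2 : ∑ i ∈ Finset.range n, g i = ∑ i ∈ Finset.range (2 * (n / 2)), g i := by
    rcases Nat.mod_two_eq_zero_or_one n with h | h
    · rw [show 2 * (n / 2) = n by omega]
    · conv_lhs => rw [show n = 2 * (n / 2) + 1 by omega]
      rw [Finset.sum_range_succ]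
      have : g (2 * (n / 2)) = 0 := by
        have hlt : ¬ 2 * (2 * (n / 2) / 2) + 1 < n := by omega
        simp only [hg, realSymbol, if_neg hlt]
        simp
      rw [this, add_zero]
  rw [h1, h2, sum_range_two_mul, Finset.mul_sum]
  refine Finset.sum_congr rfl fun t ht => ?_
  have ht' : 2 * t + 1 < n := by
    have := Finset.mem_range.1 ht
    omega
  have d1 : 2 * t / 2 = t := by omega
  have d2 : (2 * t + 1) / 2 = t := by omega
  have d3 : 2 * t % 2 = 0 := by omega
  have d4 : ¬ (2 * t + 1) % 2 = 0 := by omega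
  have hX : Measurable fun z => π t (closedLoop a π (noiseSample (n := n) θm z) t) :=
    ((hπ t).comp (measurable_closedLoop a hπ t)).comp (measurable_noiseSample θm)
  simp only [hg, realSymbol, d1, d2, if_pos ht', if_pos d3, if_neg d4]
  have hm : Measurable fun z => ENNReal.ofReal
      ((√2 * (π t (closedLoop a π (noiseSample (n := n) θm z) t)).re) ^ 2) :=
    (((Complex.measurable_re.comp hX).const_mul _).pow_const 2).ennreal_ofReal
  rw [← lintegral_add_left hm, symbolPower, realLaw,
    lintegral_map (measurable_symbol hπ t) (measurable_noiseSample θm),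
    ← lintegral_const_mul' _ _ ENNReal.ofNat_ne_top]
  refine lintegral_congr fun z => ?_
  rw [← ENNReal.ofReal_add (by positivity) (by positivity), ← ENNReal.ofReal_ofNat 2,
    ← ENNReal.ofReal_mul (by norm_num), ← Complex.normSq_eq_norm_sq,
    Complex.normSq_apply, mul_pow, mul_pow, Real.sq_sqrt zero_le_two]
  congr 1
  ring

/-- Interchanging the sums over times and messages, a bound for each message vector survives
averaging. -/
theorem avgPower_le (c : FeedbackCode k n M) {B : ℝ≥0∞}
    (h : ∀ m, ∑ i : Fin n, ∫⁻ z, ENNReal.ofReal (c.input m z i ^ 2) ∂(noiseLaw k n) ≤ B) :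
    c.avgPower ≤ B / n := by
  unfold FeedbackCode.avgPower
  gcongr
  simp only [div_eq_mul_inv]
  rw [← Finset.sum_mul, Finset.sum_comm, ← div_eq_mul_inv]
  exact ENNReal_sum_div_card_le _ h

/-! ### Bounds for the LQG codes -/

variable {G : Matrix (Fin k) (Fin k) ℂ} {α : ℝ}

theorem lintegral_realLaw_initial_le {θ : Fin k → ℂ}
    (hθ : ∀ j, θ j ∈ Set.Ioo (0 : ℝ) 1 ×ℂ Set.Ioo (0 : ℝ) 1) :
    ∫⁻ ω, ENNReal.ofReal (∑ j, ‖ω.1 j‖ ^ 2) ∂(realLaw n θ) ≤ k * 2 := by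
  have hm : Measurable fun ω : Sample k => ENNReal.ofReal (∑ j, ‖ω.1 j‖ ^ 2) :=
    (Finset.measurable_sum _ fun j _ =>
      ((measurable_pi_apply j).comp measurable_fst).norm.pow_const 2).ennreal_ofReal
  rw [realLaw, lintegral_map hm (measurable_noiseSample θ)]
  calc _ ≤ ∫⁻ _, (k * 2 : ℝ≥0∞) ∂(noiseLaw k n) := by
        refine lintegral_mono fun z => ?_
        have : ∑ j, ‖(noiseSample θ z).1 j‖ ^ 2 ≤ (k * 2 : ℝ) := by
          refine (Finset.sum_le_sum fun j _ => norm_sq_le_of_mem_unitSquare (hθ j)).trans ?_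
          simp
        refine (ENNReal.ofReal_le_ofReal this).trans (le_of_eq ?_)
        rw [ENNReal.ofReal_mul (by positivity), ENNReal.ofReal_natCast, ENNReal.ofReal_ofNat]
    _ = k * 2 := by rw [lintegral_const, measure_univ, mul_one]

/-- The power of the LQG codes exceeds the trace of `G` by at most a constant over `n`. -/
theorem exists_avgPower_le (hG : IsStabilizingDARESolution a G) :
    ∃ K : ℝ≥0∞, K ≠ ⊤ ∧ ∀ (n : ℕ) (M : Fin k → ℕ) (θ : (j : Fin k) → Fin (M j) → ℂ)
      (c : FeedbackCode k n M), n ≠ 0 → IsControlCode a (lqgControl a G) θ c →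
      (∀ j m, θ j m ∈ Set.Ioo (0 : ℝ) 1 ×ℂ Set.Ioo (0 : ℝ) 1) →
      c.avgPower ≤ K / n + ENNReal.ofReal G.trace.re := by
  obtain ⟨q, hq, hquad⟩ := exists_quad_le G
  refine ⟨2 * (ENNReal.ofReal q * (k * 2)), ?_, fun n M θ c hn hc hθ => ?_⟩
  · exact ENNReal.mul_ne_top (by simp)
      (ENNReal.mul_ne_top ENNReal.ofReal_ne_top (ENNReal.mul_ne_top (by simp) (by simp)))
  have hn' : (n : ℝ≥0∞) ≠ 0 := by exact_mod_cast hn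
  have hb : c.avgPower ≤
      (2 * (ENNReal.ofReal q * (k * 2)) + n * ENNReal.ofReal G.trace.re) / n := by
    refine avgPower_le c fun m => ?_
    rw [hc.sum_lintegral_input_sq measurable_lqgControl]
    have h := stateCost_add_sum_lqgControl (Q := realLaw n fun j => θ j (m j)) hG (n := n / 2)
      fun t ht => whiteAt_realLaw _ (by omega)
    have h0 : stateCost (realLaw n fun j => θ j (m j)) a (lqgControl a G) G 0 ≤
        ENNReal.ofReal q * (k * 2) := by
      refine (stateCost_le hq hquad 0).trans ?_
      gcongr
      exact lintegral_realLaw_initial_le fun j => hθ j (m j)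
    calc _ ≤ 2 * (ENNReal.ofReal q * (k * 2) + ((n / 2 : ℕ) : ℝ≥0∞) *
          ENNReal.ofReal G.trace.re) := by
          gcongr
          refine (le_add_self.trans h.le).trans ?_
          gcongr
      _ = 2 * (ENNReal.ofReal q * (k * 2)) + ((2 * (n / 2) : ℕ) : ℝ≥0∞) *
          ENNReal.ofReal G.trace.re := by
          push_cast
          ring
      _ ≤ _ := by
          gcongr
          omega
  refine hb.trans (le_of_eq ?_)
  rw [ENNReal.add_div, mul_comm (n : ℝ≥0∞), ENNReal.mul_div_cancel_right hn'
    (ENNReal.natCast_ne_top n)]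

theorem errorProb_le (c : FeedbackCode k n M) {B : ℝ≥0∞}
    (h : ∀ m, noiseLaw k n {z | ∃ j, c.dec j (fun i => c.output m z i j) ≠ m j} ≤ B) :
    c.errorProb ≤ B :=
  ENNReal_sum_div_card_le _ h

/-- Chebyshev bound for the error probability of the LQG codes, for message points with minimal
distance `δ j`. -/
theorem exists_errorProb_le (hG : IsStabilizingDARESolution a G) (hα : 1 < α)
    (ha : ∀ j, ‖a j‖ = α) :
    ∃ K : ℝ≥0∞, K ≠ ⊤ ∧ ∀ (n : ℕ) (M : Fin k → ℕ) (θ : (j : Fin k) → Fin (M j) → ℂ)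
      (c : FeedbackCode k n M) (δ : Fin k → ℝ), IsControlCode a (lqgControl a G) θ c →
      (∀ j m, θ j m ∈ Set.Ioo (0 : ℝ) 1 ×ℂ Set.Ioo (0 : ℝ) 1) → (∀ j, 0 < δ j) →
      (∀ j m m', m ≠ m' → δ j ≤ ‖θ j m - θ j m'‖) →
      c.errorProb ≤ ∑ j, K * ENNReal.ofReal (((α ^ (n / 2) * (δ j / 2)) ^ 2)⁻¹) := by
  obtain ⟨q, hq, hmom⟩ := exists_secondMoment_le hG hα ha
  refine ⟨ENNReal.ofReal q * (k * 2 + 1), ?_, fun n M θ c δ hc hθ hδ hsep => ?_⟩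
  · exact ENNReal.mul_ne_top ENNReal.ofReal_ne_top (by simp [ENNReal.mul_eq_top])
  refine errorProb_le c fun m => ?_
  set θm := fun j => θ j (m j) with hθm
  set N := n / 2 with hN
  have hα0 : 0 < α := by linarith
  have hsub : {z | ∃ j, c.dec j (fun i => c.output m z i j) ≠ m j} ⊆ ⋃ j,
      {z | ENNReal.ofReal ((α ^ N * (δ j / 2)) ^ 2) ≤
        ENNReal.ofReal (‖closedLoop a (lqgControl a G) (noiseSample θm z) N j‖ ^ 2)} := by
    rintro z ⟨j, hj⟩
    refine Set.mem_iUnion.2 ⟨j, ?_⟩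
    have haj : a j ≠ 0 := norm_pos_iff.1 (by rw [ha]; exact hα0)
    set y := fun i => c.output m z i j with hy
    set e := receiverEstimate (a j) (pairOutputs y) N with he
    have h1 := hc.2 j y (m j)
    have h2 := hsep j _ _ hj
    have h3 : ‖θ j (m j) - e‖ =
        (α ^ N)⁻¹ * ‖closedLoop a (lqgControl a G) (noiseSample θm z) N j‖ := by
      rw [he, hc.sub_receiverEstimate m z haj, norm_mul, norm_inv, norm_pow, ha]
    -- The decided point is no farther from the estimate than the true one, so by the triangle
    -- inequality an error forces a deviation of at least half the minimal distance.
    have h4 : δ j / 2 ≤ ‖θ j (m j) - e‖ := by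
      have : ‖θ j (c.dec j y) - θ j (m j)‖ ≤ ‖θ j (c.dec j y) - e‖ + ‖θ j (m j) - e‖ := by
        rw [← sub_sub_sub_cancel_right _ _ e]
        exact norm_sub_le _ _
      linarith
    refine ENNReal.ofReal_le_ofReal ?_
    have h5 : α ^ N * (δ j / 2) ≤ ‖closedLoop a (lqgControl a G) (noiseSample θm z) N j‖ := by
      rw [h3] at h4
      calc _ ≤ α ^ N * ((α ^ N)⁻¹ *
            ‖closedLoop a (lqgControl a G) (noiseSample θm z) N j‖) := by gcongr
        _ = _ := mul_inv_cancel_left₀ (by positivity) _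
    have := (hδ j).le
    gcongr
  refine (measure_mono hsub).trans ((measure_iUnion_fintype_le _ _).trans
    (Finset.sum_le_sum fun j _ => ?_))
  have hm : Measurable fun ω => ENNReal.ofReal (‖closedLoop a (lqgControl a G) ω N j‖ ^ 2) :=
    (((measurable_pi_apply j).comp (measurable_closedLoop a measurable_lqgControl N)).norm.pow_const
      2).ennreal_ofReal
  have hpos : 0 < (α ^ N * (δ j / 2)) ^ 2 := by
    have := hδ j
    positivity
  refine (meas_ge_le_lintegral_div ((hm.comp (measurable_noiseSample θm)).aemeasurable)
    (ENNReal.ofReal_pos.2 hpos).ne' ENNReal.ofReal_ne_top).trans ?_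
  rw [div_eq_mul_inv, ENNReal.ofReal_inv_of_pos hpos]
  gcongr
  refine (lintegral_map hm (measurable_noiseSample θm)).symm.le.trans ?_
  calc _ ≤ ∫⁻ ω, ENNReal.ofReal (∑ j, ‖closedLoop a (lqgControl a G) ω N j‖ ^ 2)
        ∂(realLaw n θm) :=
        lintegral_mono fun ω => ENNReal.ofReal_le_ofReal (sum_sq_single_le _ j)
    _ ≤ ENNReal.ofReal q * (∫⁻ ω, ENNReal.ofReal (∑ j, ‖ω.1 j‖ ^ 2) ∂(realLaw n θm) + 1) :=
        hmom (realLaw n θm) N fun t ht => whiteAt_realLaw _ (by omega)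
    _ ≤ _ := by
        gcongr
        exact lintegral_realLaw_initial_le fun j => hθ j (m j)

/-! ### Message points -/

/-- The number of cells per side of a square grid with at least `N` cells. -/
def gridSize (N : ℕ) : ℕ := N.sqrt + 1

/-- Centers of the cells of a square grid in the unit square. -/
noncomputable def gridPoint (N : ℕ) (m : Fin N) : ℂ :=
  ⟨(((m : ℕ) / gridSize N : ℕ) + 1 / 2 : ℝ) / gridSize N,
    (((m : ℕ) % gridSize N : ℕ) + 1 / 2 : ℝ) / gridSize N⟩

theorem gridSize_pos (N : ℕ) : 0 < gridSize N := Nat.succ_pos _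

theorem div_gridSize_lt {N : ℕ} (m : Fin N) : (m : ℕ) / gridSize N < gridSize N :=
  Nat.div_lt_of_lt_mul (m.2.trans (Nat.lt_succ_sqrt N))

theorem add_half_div_mem_Ioo {i L : ℕ} (h : i < L) : (i + 1 / 2 : ℝ) / L ∈ Set.Ioo (0 : ℝ) 1 := by
  have hL : (0 : ℝ) < L := by exact_mod_cast (Nat.zero_le i).trans_lt h
  have : (i : ℝ) + 1 ≤ L := by exact_mod_cast h
  refine ⟨by positivity, ?_⟩
  rw [div_lt_one hL]
  linarith

theorem gridPoint_mem (N : ℕ) (m : Fin N) :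
    gridPoint N m ∈ Set.Ioo (0 : ℝ) 1 ×ℂ Set.Ioo (0 : ℝ) 1 :=
  ⟨add_half_div_mem_Ioo (div_gridSize_lt m),
    add_half_div_mem_Ioo (Nat.mod_lt _ (gridSize_pos N))⟩

theorem inv_le_abs_sub {i j L : ℕ} (h : i ≠ j) :
    (L : ℝ)⁻¹ ≤ |(i + 1 / 2 : ℝ) / L - (j + 1 / 2 : ℝ) / L| := by
  rw [← sub_div, abs_div, Nat.abs_cast, inv_eq_one_div]
  gcongr
  rw [add_sub_add_right_eq_sub]
  have : (1 : ℤ) ≤ |(i : ℤ) - j| := Int.one_le_abs (sub_ne_zero.2 (by exact_mod_cast h))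
  exact_mod_cast this

theorem inv_gridSize_le (N : ℕ) (m m' : Fin N) (h : m ≠ m') :
    (gridSize N : ℝ)⁻¹ ≤ ‖gridPoint N m - gridPoint N m'‖ := by
  by_cases h1 : (m : ℕ) / gridSize N = (m' : ℕ) / gridSize N
  · have h2 : (m : ℕ) % gridSize N ≠ (m' : ℕ) % gridSize N := fun h2 => h <| Fin.ext <| by
      rw [← Nat.div_add_mod (m : ℕ) (gridSize N), h1, h2, Nat.div_add_mod]
    exact (inv_le_abs_sub h2).trans (Complex.abs_im_le_norm (gridPoint N m - gridPoint N m'))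
  · exact (inv_le_abs_sub h1).trans (Complex.abs_re_le_norm (gridPoint N m - gridPoint N m'))

/-- The grid spacing is thus at least 1/(2√N). The square root from the two real dimensions
compensates for having only n/2 complex transmissions. -/
theorem gridSize_sq_le {N : ℕ} (hN : 0 < N) : (gridSize N : ℝ) ^ 2 ≤ 4 * N := by
  have h1 : 1 ≤ N.sqrt := Nat.sqrt_pos.2 hN
  have h2 : N.sqrt * N.sqrt ≤ N := Nat.sqrt_le N
  have : gridSize N ^ 2 ≤ 4 * N := by
    rw [gridSize]
    nlinarith
  exact_mod_cast this

theorem messageCount_pos (n : ℕ) (R : ℝ) : 0 < messageCount n R :=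
  Nat.ceil_pos.2 (by positivity)

theorem messageCount_le (n : ℕ) (R : ℝ) : (messageCount n R : ℝ) ≤ ((2 : ℝ) ^ R) ^ n + 1 := by
  rw [← Real.rpow_natCast ((2 : ℝ) ^ R), ← Real.rpow_mul zero_le_two, mul_comm R]
  exact (Nat.ceil_lt_add_one (by positivity)).le

/-! ### Achievability of the rates in the open region -/

/-- The LQG codes achieve all rates below `log α`. -/
theorem controlAchieves_lqgControl (hG : IsStabilizingDARESolution a G) (hα : 1 < α)
    (ha : ∀ j, ‖a j‖ = α) {r : Fin k → ℝ} (hr : ∀ j, r j < Real.logb 2 α) :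
    ControlAchieves a (lqgControl a G) G.trace.re r := by
  have hα0 : 0 < α := by linarith
  set θ : (n : ℕ) → (j : Fin k) → Fin (messageCount n (r j)) → ℂ := fun n j m => gridPoint _ m
    with hθ
  have hmem : ∀ n j m, θ n j m ∈ Set.Ioo (0 : ℝ) 1 ×ℂ Set.Ioo (0 : ℝ) 1 := fun n j m =>
    gridPoint_mem _ m
  choose c hc using fun n => exists_isControlCode (n := n) (a := a) (π := lqgControl a G)
    measurable_lqgControl (fun j => messageCount_pos n (r j)) (θ n)
  refine ⟨θ, c, hmem, hc, ?_, ?_⟩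
  · obtain ⟨K, hK, hbound⟩ := exists_errorProb_le hG hα ha
    -- The first power comes from 2^(nr) messages, the second from rounding up their number. In 16α,
    -- one factor 4 is from halving the spacing, one from `gridSize_sq_le`, and α from rounding n/2
    -- down.
    have hlim : ∀ j, Tendsto (fun n : ℕ => K * ENNReal.ofReal
        (16 * α * (((2 : ℝ) ^ r j / α) ^ n + (1 / α) ^ n))) atTop (𝓝 0) := by
      intro j
      have h2r : (2 : ℝ) ^ r j < α := by
        rw [← Real.lt_logb_iff_rpow_lt (by norm_num) hα0]
        exact hr j
      have h1 := tendsto_pow_atTop_nhds_zero_of_lt_one (r := (2 : ℝ) ^ r j / α) (by positivity)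
        ((div_lt_one hα0).2 h2r)
      have h2 := tendsto_pow_atTop_nhds_zero_of_lt_one (r := 1 / α) (by positivity)
        ((div_lt_one hα0).2 hα)
      have h3 := ENNReal.tendsto_ofReal ((h1.add h2).const_mul (16 * α))
      rw [add_zero, mul_zero, ENNReal.ofReal_zero] at h3
      have h4 := ENNReal.Tendsto.const_mul (a := K) h3 (Or.inr hK)
      rwa [mul_zero] at h4
    have hsum := tendsto_finsetSum Finset.univ fun j (_ : j ∈ Finset.univ) => hlim j
    rw [Finset.sum_const_zero] at hsum
    refine tendsto_of_tendsto_of_tendsto_of_le_of_le tendsto_const_nhds hsum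
      (fun _ => zero_le) fun n => ?_
    refine (hbound n _ (θ n) (c n) (fun j => (gridSize (messageCount n (r j)) : ℝ)⁻¹) (hc n)
      (hmem n) (fun j => inv_pos.2 (by exact_mod_cast gridSize_pos _))
      fun j m m' h => inv_gridSize_le _ m m' h).trans ?_
    refine Finset.sum_le_sum fun j _ => ?_
    gcongr
    set L : ℝ := (gridSize (messageCount n (r j)) : ℝ) with hL
    have hL0 : 0 < L := Nat.cast_pos.2 (gridSize_pos _)
    have hL2 : L ^ 2 ≤ 4 * (((2 : ℝ) ^ r j) ^ n + 1) :=
      (gridSize_sq_le (messageCount_pos n (r j))).trans (by gcongr; exact messageCount_le n (r j))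
    have hpow : α ^ n ≤ α * (α ^ (n / 2)) ^ 2 := by
      rw [← pow_mul, ← pow_succ']
      exact pow_le_pow_right₀ hα.le (by omega)
    have hA : 0 < α ^ (n / 2) := by positivity
    calc ((α ^ (n / 2) * (L⁻¹ / 2)) ^ 2)⁻¹ = 4 * L ^ 2 / (α ^ (n / 2)) ^ 2 := by
          field_simp
          norm_num
      _ ≤ 4 * L ^ 2 * (α / α ^ n) := by
          rw [div_eq_mul_inv]
          gcongr
          rw [inv_le_comm₀ (by positivity) (by positivity), inv_div, div_le_iff₀ hα0, mul_comm]
          exact hpow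
      _ ≤ 4 * (4 * (((2 : ℝ) ^ r j) ^ n + 1)) * (α / α ^ n) := by gcongr
      _ = _ := by
          rw [div_pow, div_pow, one_pow]
          field_simp
          ring
  · obtain ⟨K, hK, hbound⟩ := exists_avgPower_le hG
    have ht := (tendsto_const_div_natCast hK).add
      (tendsto_const_nhds (x := ENNReal.ofReal G.trace.re))
    rw [zero_add] at ht
    rw [← ht.limsup_eq]
    refine limsup_le_limsup ?_
    filter_upwards [eventually_ne_atTop 0] with n hn
    exact hbound n _ (θ n) (c n) hn (hc n) (hmem n)

end GaussianBC

namespace GaussianBC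

variable {k : ℕ}

/-! ### The power gain -/

/-- Each summand is strictly increasing. This makes the power determine the pole, and drives the
uniqueness of φ. -/
theorem lqgPower_lt (hk : k ≠ 0) {x y : ℝ} (hx : 0 < x) (hxy : x < y) :
    lqgPower k x < lqgPower k y := by
  have hkR : (0 : ℝ) < k := by exact_mod_cast Nat.pos_of_ne_zero hk
  unfold lqgPower
  refine mul_lt_mul_of_pos_left ?_ (inv_pos.2 hkR)
  refine Finset.sum_lt_sum_of_nonempty (Finset.nonempty_range_iff.2 hk) fun i _ => ?_
  have h1 : x ^ (i + 1) < y ^ (i + 1) := pow_lt_pow_left₀ hxy hx.le (Nat.succ_ne_zero i)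
  have h2 : (y ^ i)⁻¹ ≤ (x ^ i)⁻¹ := by gcongr
  linarith

theorem lqgPower_injective (hk : k ≠ 0) {x y : ℝ} (hx : 0 < x) (hy : 0 < y)
    (h : lqgPower k x = lqgPower k y) : x = y := by
  rcases lt_trichotomy x y with h1 | h1 | h1
  · exact absurd h (lqgPower_lt hk hx h1).ne
  · exact h1
  · exact absurd h (lqgPower_lt hk hy h1).ne'

theorem lqgPower_one : lqgPower k 1 = 0 := by simp [lqgPower]

theorem lqgPower_pos (hk : k ≠ 0) {x : ℝ} (hx : 1 < x) : 0 < lqgPower k x := by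
  rw [← lqgPower_one (k := k)]
  exact lqgPower_lt hk one_pos hx

theorem sub_one_le_lqgPower (hk : k ≠ 0) {x : ℝ} (hx : 1 ≤ x) : x - 1 ≤ lqgPower k x := by
  have hkR : (k : ℝ) ≠ 0 := by exact_mod_cast hk
  have : ∑ _i ∈ Finset.range k, (x - 1) ≤ ∑ i ∈ Finset.range k, (x ^ (i + 1) - (x ^ i)⁻¹) := by
    refine Finset.sum_le_sum fun i _ => ?_
    have h1 : x ≤ x ^ (i + 1) := le_self_pow₀ hx (Nat.succ_ne_zero i)
    have h2 : (x ^ i)⁻¹ ≤ 1 := inv_le_one_of_one_le₀ (one_le_pow₀ hx)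
    linarith
  rw [Finset.sum_const, Finset.card_range, nsmul_eq_mul] at this
  rw [lqgPower]
  calc x - 1 = (k : ℝ)⁻¹ * (k * (x - 1)) := (inv_mul_cancel_left₀ hkR _).symm
    _ ≤ _ := by gcongr

theorem exists_lqgPower_eq (hk : k ≠ 0) {P : ℝ} (hP : 0 < P) : ∃ x, 1 < x ∧ lqgPower k x = P := by
  have hc : ContinuousOn (lqgPower k) (Set.Icc 1 (P + 1)) := by
    unfold lqgPower
    refine ContinuousOn.mul continuousOn_const (continuousOn_finsetSum _ fun i _ => ?_)
    refine (continuousOn_id.pow _).sub ((continuousOn_id.pow _).inv₀ fun x hx => ?_)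
    have : (0 : ℝ) < x := by linarith [hx.1]
    exact pow_ne_zero _ this.ne'
  -- The right endpoint P + 1 suffices because the power at x is at least x − 1.
  have h := intermediate_value_Icc (by linarith : (1 : ℝ) ≤ P + 1) hc
  obtain ⟨x, hx, hxP⟩ : P ∈ lqgPower k '' Set.Icc 1 (P + 1) := h ⟨by rw [lqgPower_one]; exact hP.le, by
    simpa using sub_one_le_lqgPower hk (by linarith : (1 : ℝ) ≤ P + 1)⟩
  refine ⟨x, lt_of_le_of_ne hx.1 fun h1 => ?_, hxP⟩
  rw [← h1, lqgPower_one] at hxP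
  exact hP.ne hxP

theorem natCast_mul_lqgPower (hk : k ≠ 0) {x : ℝ} (hx : 0 < x) :
    k * lqgPower k x * x ^ (k - 1) = (∑ i ∈ Finset.range k, x ^ i) * (x ^ k - 1) := by
  have hkR : (k : ℝ) ≠ 0 := by exact_mod_cast hk
  have h2 : (∑ i ∈ Finset.range k, (x ^ i)⁻¹) * x ^ (k - 1) = ∑ i ∈ Finset.range k, x ^ i := by
    rw [← Finset.sum_range_reflect, Finset.sum_mul]
    refine Finset.sum_congr rfl fun i hi => ?_
    have hi' : i < k := Finset.mem_range.1 hi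
    have : x ^ (k - 1) = x ^ (k - 1 - i) * x ^ i := by rw [← pow_add]; congr 1; omega
    rw [this]
    field_simp
  have h1 : ∑ i ∈ Finset.range k, x ^ (i + 1) = (∑ i ∈ Finset.range k, x ^ i) * x := by
    rw [Finset.sum_mul]
    rfl
  have hxk : x ^ k = x * x ^ (k - 1) := by rw [← pow_succ']; congr 1; omega
  rw [lqgPower, mul_inv_cancel_left₀ hkR, Finset.sum_sub_distrib, sub_mul, h2, h1, hxk]
  ring

/-- Closed form of the power. It is multiplied out so that it can be matched with the equation for
φ. -/
theorem natCast_mul_lqgPower_sq (hk : k ≠ 0) {x : ℝ} (hx : 0 < x) :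
    k * lqgPower k x * x ^ (k - 1) * (x - 1) = (x ^ k - 1) ^ 2 := by
  rw [natCast_mul_lqgPower hk hx, mul_right_comm, geom_sum_mul, sq]

/-- Put 1 + Pφ = y^k. Taking k-th roots, the equation for φ becomes y^k − y^(k−1) = Pφ²/k, that is k
P y^(k−1) (y − 1) = (y^k − 1)². The power at y is therefore P, and injectivity gives y = x. -/
theorem isPowerGain_iff (hk : k ≠ 0) {x : ℝ} (hx : 1 < x) {φ : ℝ} :
    IsPowerGain k (lqgPower k x) φ ↔ 1 + lqgPower k x * φ = x ^ k := by
  have hkR : (0 : ℝ) < k := by exact_mod_cast Nat.pos_of_ne_zero hk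
  have hP := lqgPower_pos hk hx
  have hx0 : 0 < x := by linarith
  set P := lqgPower k x with hPdef
  constructor
  · rintro ⟨⟨h1, h2⟩, h3⟩
    set y := (1 + P * φ) ^ ((k : ℝ)⁻¹) with hy
    have hpos : 0 < P * φ := mul_pos hP (by linarith)
    have hyk : y ^ k = 1 + P * φ := Real.rpow_inv_natCast_pow (by linarith) hk
    have hy1 : 1 < y := Real.one_lt_rpow (by linarith) (inv_pos.2 hkR)
    have hy0 : 0 < y := by linarith
    -- The root may be taken because φ ≤ k makes the right side nonnegative.
    have h4 : y ^ (k - 1) = 1 + P / k * φ * (k - φ) := by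
      refine (pow_left_inj₀ (by positivity) ?_ hk).1 ?_
      · have : 0 ≤ P / k * φ * (k - φ) :=
          mul_nonneg (mul_nonneg (div_pos hP hkR).le (by linarith)) (by linarith)
        linarith
      · rw [← h3, ← hyk, pow_right_comm]
    have h5 : k * P * y ^ (k - 1) * (y - 1) = (y ^ k - 1) ^ 2 := by
      have e : y ^ k = y ^ (k - 1) * y := by rw [← pow_succ]; congr 1; omega
      have h6 : y ^ (k - 1) * (y - 1) = P / k * φ ^ 2 := by
        have : y ^ (k - 1) * (y - 1) = y ^ k - y ^ (k - 1) := by rw [e]; ring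
        rw [this, hyk, h4]
        field_simp
        ring
      rw [mul_assoc, h6, hyk]
      field_simp
      ring
    rw [← natCast_mul_lqgPower_sq hk hy0] at h5
    have h7 : P = lqgPower k y := by
      have hp : y ^ (k - 1) ≠ 0 := by positivity
      have h8 := mul_right_cancel₀ hp (mul_right_cancel₀ (by linarith : y - 1 ≠ 0) h5)
      exact mul_left_cancel₀ hkR.ne' h8
    rw [← hyk, lqgPower_injective hk hx0 hy0 h7]
  · intro h
    have hφ : P * φ = x ^ k - 1 := by linarith
    have hid := natCast_mul_lqgPower hk hx0
    rw [← hPdef] at hid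
    have hxk1 : 0 < x ^ (k - 1) := by positivity
    have hxk : 0 < x ^ k - 1 := by linarith [one_lt_pow₀ hx hk]
    -- By `hid`, φ equals k x^(k−1) divided by this geometric sum, so the two bounds on the sum are
    -- exactly 1 ≤ φ and φ ≤ k.
    have hs1 : ∑ i ∈ Finset.range k, x ^ i ≤ k * x ^ (k - 1) := by
      calc _ ≤ ∑ _i ∈ Finset.range k, x ^ (k - 1) := by
            refine Finset.sum_le_sum fun i hi => pow_le_pow_right₀ hx.le ?_
            have := Finset.mem_range.1 hi
            omega
        _ = _ := by simp
    have hs2 : x ^ (k - 1) ≤ ∑ i ∈ Finset.range k, x ^ i :=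
      Finset.single_le_sum (f := fun i => x ^ i) (fun i _ => by positivity)
        (Finset.mem_range.2 (by omega))
    refine ⟨⟨?_, ?_⟩, ?_⟩
    · refine le_of_mul_le_mul_left ?_ hP
      rw [mul_one, hφ]
      refine le_of_mul_le_mul_left ?_ (mul_pos hkR hxk1)
      nlinarith
    · refine le_of_mul_le_mul_left ?_ hP
      rw [hφ]
      refine le_of_mul_le_mul_left ?_ hxk1
      nlinarith
    · have h5 := natCast_mul_lqgPower_sq hk hx0
      rw [← hPdef, ← hφ] at h5
      have e : x ^ k = x ^ (k - 1) * x := by rw [← pow_succ]; congr 1; omega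
      have h6 : 1 + P / k * φ * (k - φ) = x ^ (k - 1) := by
        have h7 : k * (x ^ (k - 1) * (x - 1)) = P * φ ^ 2 := by
          refine mul_left_cancel₀ hP.ne' ?_
          linear_combination h5
        have h8 : P / k * φ * (k - φ) = P * φ - P * φ ^ 2 / k := by
          field_simp
        rw [h8, ← h7, mul_div_cancel_left₀ _ hkR.ne', hφ, e]
        ring
      rw [h6, h, pow_right_comm]

theorem existsUnique_isPowerGain (hk : k ≠ 0) {P : ℝ} (hP : 0 < P) : ∃! φ, IsPowerGain k P φ := by
  obtain ⟨x, hx, rfl⟩ := exists_lqgPower_eq hk hP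
  refine ⟨(x ^ k - 1) / lqgPower k x, (isPowerGain_iff hk hx).2 ?_, fun φ hφ => ?_⟩
  · rw [mul_div_cancel₀ _ hP.ne']
    ring
  · have := (isPowerGain_iff hk hx).1 hφ
    rw [eq_div_iff hP.ne']
    linarith

theorem logb_eq_sumRate_div (hk : k ≠ 0) {a φ : ℝ} (ha : 1 < a)
    (hφ : IsPowerGain k (lqgPower k (a ^ 2)) φ) :
    Real.logb 2 a = sumRate (lqgPower k (a ^ 2)) φ / k := by
  have hkR : (k : ℝ) ≠ 0 := by exact_mod_cast hk
  rw [sumRate, (isPowerGain_iff hk (one_lt_pow₀ ha two_ne_zero)).1 hφ, Real.logb_pow,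
    Real.logb_pow]
  field_simp
  norm_num

/-! ### Rates on the boundary -/

theorem ControlAchieves.achievable {a : Fin k → ℂ} {π : Control k} {P : ℝ} {r : Fin k → ℝ}
    (h : ControlAchieves a π P r) : Achievable k P r := by
  obtain ⟨_, c, _, _, h1, h2⟩ := h
  exact ⟨c, h1, h2⟩

/-- Achievability is closed under decreasing limits of the power constraint. -/
theorem achievable_of_forall_gt {P : ℝ} (hP : 0 ≤ P) {r : Fin k → ℝ}
    (h : ∀ P', P < P' → Achievable k P' r) : Achievable k P r := by
  set ε : ℕ → ℝ := fun m => 1 / ((m : ℝ) + 1) with hε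
  have hε0 : ∀ m, 0 < ε m := fun m => by simp only [hε]; positivity
  have hεlim : Tendsto ε atTop (𝓝 0) := tendsto_one_div_add_atTop_nhds_zero_nat
  choose c hc1 hc2 using fun m => h (P + ε m) (by linarith [hε0 m])
  have hev : ∀ m, ∃ N, ∀ n, N ≤ n → (c m n).errorProb < ENNReal.ofReal (ε m) ∧
      (c m n).avgPower < ENNReal.ofReal (P + 2 * ε m) := by
    intro m
    have e1 := (hc1 m).eventually (gt_mem_nhds (ENNReal.ofReal_pos.2 (hε0 m)))
    have e2 := eventually_lt_of_limsup_lt ((hc2 m).trans_lt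
      ((ENNReal.ofReal_lt_ofReal_iff (by linarith [hε0 m])).2
        (by linarith [hε0 m] : P + ε m < P + 2 * ε m)))
    exact eventually_atTop.1 (e1.and e2)
  choose N hN using hev
  -- Diagonal choice: at length n use the code sequence with the smallest excess power whose
  -- guarantees have already set in. The cap m ≤ n keeps the maximum finite, and for n < N 0 the
  -- default value 0 carries no guarantee.
  set μ : ℕ → ℕ := fun n => Nat.findGreatest (fun m => N m ≤ n) n with hμ
  have hμlim : Tendsto μ atTop atTop := by
    refine tendsto_atTop.2 fun m => ?_
    filter_upwards [eventually_ge_atTop (max m (N m))] with n hn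
    exact Nat.le_findGreatest ((le_max_left _ _).trans hn) ((le_max_right _ _).trans hn)
  have hgood : ∀ᶠ n in atTop, N (μ n) ≤ n := by
    filter_upwards [eventually_ge_atTop (N 0)] with n hn
    exact Nat.findGreatest_spec (P := fun m => N m ≤ n) (Nat.zero_le n) hn
  have hεμ := hεlim.comp hμlim
  refine ⟨fun n => c (μ n) n, ?_, ?_⟩
  · have hl := ENNReal.tendsto_ofReal hεμ
    rw [ENNReal.ofReal_zero] at hl
    refine tendsto_of_tendsto_of_tendsto_of_le_of_le' tendsto_const_nhds hl
      (Eventually.of_forall fun _ => zero_le) ?_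
    filter_upwards [hgood] with n hn
    exact (hN (μ n) n hn).1.le
  · have hl := ENNReal.tendsto_ofReal ((tendsto_const_nhds (x := P)).add (hεμ.const_mul 2))
    rw [mul_zero, add_zero] at hl
    rw [← hl.limsup_eq]
    refine limsup_le_limsup ?_
    filter_upwards [hgood] with n hn
    exact (hN (μ n) n hn).2.le

end GaussianBC

/-! ### Assembly of the theorem -/

theorem theorem2 (k : ℕ) (hk : 1 ≤ k) :
    -- the power gain `φ(k, P)` is well defined
    (∀ P : ℝ, 0 < P → ∃! φ : ℝ, IsPowerGain k P φ) ∧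
    -- the LQG control is well defined
    (∀ a : ℝ, 1 < a → ∃! G : Matrix (Fin k) (Fin k) ℂ,
      IsStabilizingDARESolution (symmetricPoles k a) G) ∧
    -- performance of the LQG code for every `a > 1`, where `P` is its asymptotic power
    (∀ a : ℝ, 1 < a → ∀ G : Matrix (Fin k) (Fin k) ℂ,
      IsStabilizingDARESolution (symmetricPoles k a) G → ∀ P : ℝ, P = G.trace.re →
        0 < P ∧
        IsMinimumPowerControl (symmetricPoles k a) (lqgControl (symmetricPoles k a) G) ∧
        Tendsto (controlPower (symmetricPoles k a) (lqgControl (symmetricPoles k a) G)) atTop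
          (𝓝 (ENNReal.ofReal P)) ∧
        ∀ φ : ℝ, IsPowerGain k P φ →
          Real.logb 2 a = sumRate P φ / k ∧
          (∀ j : Fin k, HasMSEExponent (symmetricPoles k a)
            (lqgControl (symmetricPoles k a) G) j (sumRate P φ / k)) ∧
          ∀ r : Fin k → ℝ, (∀ j, r j < sumRate P φ / k) →
            ControlAchieves (symmetricPoles k a) (lqgControl (symmetricPoles k a) G) P r) ∧
    -- every power `P > 0` is the asymptotic power of exactly one of these codes
    (∀ P : ℝ, 0 < P → ∃! a : ℝ, 1 < a ∧ ∀ G : Matrix (Fin k) (Fin k) ℂ,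
      IsStabilizingDARESolution (symmetricPoles k a) G → G.trace.re = P) ∧
    -- the symmetric rate vector with sum `R(k, P)` is achievable under power constraint `P`
    (∀ P : ℝ, 0 < P → ∀ φ : ℝ, IsPowerGain k P φ →
      Achievable k P (fun _ => sumRate P φ / k)) := by
  have hk0 : k ≠ 0 := by omega
  have htrace : ∀ {a : ℝ}, 1 < a → ∀ {G : Matrix (Fin k) (Fin k) ℂ},
      IsStabilizingDARESolution (symmetricPoles k a) G → G.trace.re = lqgPower k (a ^ 2) := by
    intro a ha G hG
    rw [(isStabilizingDARESolution_iff ha hk0).1 hG, trace_inv_steinMatrix ha hk0]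
  have hsqrt : ∀ {P : ℝ}, 0 < P → ∃ a : ℝ, 1 < a ∧ lqgPower k (a ^ 2) = P := by
    intro P hP
    obtain ⟨x, hx, hxP⟩ := exists_lqgPower_eq hk0 hP
    refine ⟨√x, Real.lt_sqrt_of_sq_lt (by rwa [one_pow]), ?_⟩
    rwa [Real.sq_sqrt (by linarith)]
  refine ⟨fun P hP => existsUnique_isPowerGain hk0 hP, fun a ha => ?_, fun a ha G hG P hP => ?_,
    fun P hP => ?_, fun P hP φ hφ => ?_⟩
  · exact ⟨_, (isStabilizingDARESolution_iff ha hk0).2 rfl,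
      fun G hG => (isStabilizingDARESolution_iff ha hk0).1 hG⟩
  · have hn := norm_symmetricPoles (k := k) (by linarith : 0 ≤ a)
    have hPa : P = lqgPower k (a ^ 2) := hP.trans (htrace ha hG)
    refine ⟨?_, isMinimumPowerControl_lqgControl hG ha hn, ?_, fun φ hφ => ?_⟩
    · rw [hPa]
      exact lqgPower_pos hk0 (one_lt_pow₀ ha two_ne_zero)
    · rw [hP]
      exact tendsto_controlPower_lqgControl hG ha hn
    · have hlog : Real.logb 2 a = sumRate P φ / k := by
        rw [hPa] at hφ ⊢
        exact logb_eq_sumRate_div hk0 ha hφ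
      rw [← hlog]
      refine ⟨rfl, fun j => hasMSEExponent_lqgControl hG ha hn j, fun r hr => ?_⟩
      rw [hP]
      exact controlAchieves_lqgControl hG ha hn hr
  · obtain ⟨a, ha, haP⟩ := hsqrt hP
    refine ⟨a, ⟨ha, fun G hG => (htrace ha hG).trans haP⟩, fun b ⟨hb, hbP⟩ => ?_⟩
    have h1 := hbP _ ((isStabilizingDARESolution_iff hb hk0).2 rfl)
    rw [trace_inv_steinMatrix hb hk0, ← haP] at h1
    have h2 := lqgPower_injective hk0 (by positivity) (by positivity) h1
    exact (pow_left_inj₀ (by linarith) (by linarith) two_ne_zero).1 h2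
  · obtain ⟨a, ha, rfl⟩ := hsqrt hP
    -- The boundary rate for P equals log a. Any larger power belongs to a pole b > a, whose open
    -- rate region contains it strictly.
    refine achievable_of_forall_gt hP.le fun P' hP' => ?_
    obtain ⟨b, hb, rfl⟩ := hsqrt (hP.trans hP')
    have hab : a < b := by
      by_contra! hba
      rcases hba.eq_or_lt with rfl | hlt
      · exact lt_irrefl _ hP'
      · exact lt_asymm hP' (lqgPower_lt hk0 (by positivity) (by gcongr))
    have hG := (isStabilizingDARESolution_iff hb hk0).2 rfl
    have h := controlAchieves_lqgControl hG hb (norm_symmetricPoles (k := k) (by linarith))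
      (r := fun _ => sumRate (lqgPower k (a ^ 2)) φ / k) fun j => by
        rw [← logb_eq_sumRate_div hk0 ha hφ]
        exact Real.logb_lt_logb (by norm_num) (by linarith) hab
    rw [trace_inv_steinMatrix hb hk0] at h
    exact h.achievable
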